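/- Let $n\equiv 2 \pmod 4$ and let $q\equiv 3\pmod 4$ be a prime power. An element $g$ of a group $G$ is called real in $G$ if $hgh^{-1}=g^{-1}$ for some $h\in G$; a conjugacy class is real if its elements are. For $g\in GL_n(q)$ let $p_1(t)^{a_1},\dots,p_r(t)^{a_r}$ ($p_j$ monic irreducible, $a_j\ge 1$) be the elementary divisors of $g$, i.e. $\mathbb F_q^n$ with $t$ acting as $g$ is isomorphic to $\bigoplus_j \mathbb F_q[t]/(p_j^{a_j})$ as an $\mathbb F_q[t]$-module. The type of $g$ is the partition $\nu=1^{n_1}2^{n_2}\cdots$ of $n$ with $n_i=\deg\prod_{j:\,a_j=i}p_j$. (1) Let $g\in SL_n(q)$ be of type $\nu=1^{n_1}2^{n_2}\cdots$ and real in $GL_n(q)$. Then $g$ is real in $SL_n(q)$ if and only if $n_i>0$ for some odd $i$. (2) The number of real conjugacy classes of $SL_n(q)$ is $$\sum_{|\nu|=n}h_\nu\, sl_\nu-\sum_{\mu}h_\mu\, sl_\mu ,$$ where $\nu$ runs over all partitions of $n$ and $\mu$ over the partitions of $n$ all of whose parts are even. Here, for $\nu=\{\nu_1,\dots,\nu_s\}=1^{n_1}2^{n_2}\cdots$,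 $h_\nu=\gcd(q-1,\nu_1,\dots,\nu_s)$ and $$sl_\nu=\begin{cases}\prod_{n_i>0} n_{q,n_i}, & \text{if } n_i=0 \text{ for all odd } i,\\ \tfrac12\prod_{n_i>0} n_{q,n_i}, & \text{if } i n_i \text{ is odd for some } i,\\ \dfrac{(q+1)^{r}+(q-1)^{r}}2\ \prod_{i\text{ odd},\,n_i>0}q^{\frac{n_i}2-1}\prod_{i\text{ even},\,n_i>0}n_{q,n_i}, & \text{otherwise,}\end{cases}$$ where $r$ is the number of odd $i$ with $n_i>0$, and $n_{q,d}$ is the number of self-reciprocal polynomials $f\in\mathbb F_q[t]$ of degree $d$ with $f(0)=1$; $f$ is self-reciprocal if the multiset of its roots in $\overline{\mathbb F_q}$ is invariant under $\alpha\mapsto\alpha^{-1}$. -/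

import Mathlib

open scoped DirectSum Polynomial MatrixGroups

/-- An element `g` of a group `G` is real (in `G`) if some `h ∈ G` satisfies `h g h⁻¹ = g⁻¹`. -/
def IsRealElement {G : Type*} [Group G] (g : G) : Prop :=
  ∃ h : G, h * g * h⁻¹ = g⁻¹

/-- The number of real conjugacy classes of `G`, i.e. of the classes of real elements. -/
noncomputable def numRealClasses (G : Type*) [Group G] : ℕ :=
  Nat.card {C : ConjClasses G // ∃ g : G, ConjClasses.mk g = C ∧ IsRealElement g}

/-- `K^n`, with `X` acting as `g`, is as a `K[X]`-module the direct sum of the cyclic modules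
`K[X] / (p_j ^ a_j)`, where every `p_j` is monic irreducible and every `a_j` is positive. -/
def HasElementaryDivisors {K : Type*} [Field K] {n : ℕ} (g : GL (Fin n) K) {r : ℕ}
    (p : Fin r → K[X]) (a : Fin r → ℕ) : Prop :=
  (∀ j, (p j).Monic ∧ Irreducible (p j)) ∧ (∀ j, 0 < a j) ∧
    Nonempty (Module.AEval' (Matrix.toLin' (g : Matrix (Fin n) (Fin n) K)) ≃ₗ[K[X]]
      ⨁ j : Fin r, K[X] ⧸ Ideal.span {p j ^ a j})

/-- `g` is of type `ν = 1^{n_1} 2^{n_2} ⋯`: if the `p_j ^ a_j` are the elementary divisors of `g`,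
then `n_i` is the degree of the product of all `p_j` with `a_j = i`. -/
def HasPartitionType {K : Type*} [Field K] {n : ℕ} (g : GL (Fin n) K) (ν : n.Partition) : Prop :=
  ∃ (r : ℕ) (p : Fin r → K[X]) (a : Fin r → ℕ), HasElementaryDivisors g p a ∧
    ∀ i : ℕ, ν.parts.count i = (∏ j : Fin r with a j = i, p j).natDegree

/-- The list of roots of `f` in an algebraic closure, with multiplicity, is invariant under
inversion. -/
def IsSelfReciprocal {K : Type*} [Field K] (f : K[X]) : Prop :=
  (f.aroots (AlgebraicClosure K)).map (fun α => α⁻¹) = f.aroots (AlgebraicClosure K)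

/-- `n_{q,d}`: the number of self-reciprocal polynomials of degree `d` over `K` (the field with `q`
elements) with constant term `1`. -/
noncomputable def numSelfReciprocal (K : Type*) [Field K] (d : ℕ) : ℕ :=
  Nat.card {f : K[X] // f.natDegree = d ∧ f.coeff 0 = 1 ∧ IsSelfReciprocal f}

/-- `h_ν = gcd(q - 1, ν_1, …, ν_r)`. -/
def hNu (q : ℕ) {n : ℕ} (ν : n.Partition) : ℕ :=
  Nat.gcd (q - 1) ν.parts.gcd

open Classical in
/-- The number `sl_ν` for `ν = 1^{n_1} 2^{n_2} ⋯`, with `n_i = ν.parts.count i` and `q = |K|`. All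
products run over the `i` with `n_i > 0`. In the last case `n_i` is even for all odd `i`. -/
noncomputable def slNu (K : Type*) [Field K] {n : ℕ} (ν : n.Partition) : ℚ :=
  if Even (Nat.card K) ∨ ∀ i, Odd i → ν.parts.count i = 0 then
    ∏ i ∈ ν.parts.toFinset, (numSelfReciprocal K (ν.parts.count i) : ℚ)
  else if ∃ i, Odd (i * ν.parts.count i) then
    1 / 2 * ∏ i ∈ ν.parts.toFinset, (numSelfReciprocal K (ν.parts.count i) : ℚ)
  else
    (((Nat.card K : ℚ) + 1) ^ (ν.parts.toFinset.filter Odd).card +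
        ((Nat.card K : ℚ) - 1) ^ (ν.parts.toFinset.filter Odd).card) / 2 *
      (∏ i ∈ ν.parts.toFinset.filter Odd, (Nat.card K : ℚ) ^ (ν.parts.count i / 2 - 1)) *
      ∏ i ∈ ν.parts.toFinset.filter Even, (numSelfReciprocal K (ν.parts.count i) : ℚ)

/-! Whether an inverting element can be given determinant 1 depends on which determinants occur
among the elements centralizing or inverting `g`. Let γ be the gcd of the parts of ν. Multiplication
by `Q` on K[X]/(p^a) has determinant the a-th power of a norm from K[X]/(p), and norms between
finite fields are surjective; so the centralizer realizes every a-th power, hence every γ-th power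
(`exists_det_pi_eq_pow`).

For the upper bound let b be the part of the order of `g` prime to the characteristic. Then N = g^b
- g^(-b) is nilpotent with n_i Jordan blocks of size i (`HasDivisorFamily.exists_rank_add`). It
commutes with the centralizer and anticommutes with every inverting element. Along the filtration by
the spaces N^k V, a map h with hN = ωNh has determinant equal to the product of its determinants on
N^k V ∩ ker N, times a power of ω. If all block sizes are divisible by d these spaces repeat d
times, so det h is a d-th power times that power of ω (`exists_det_eq_pow_mul`). With d = γ and ω =
1 this gives exactly the γ-th powers (`HasDivisorFamily.detCentralizer_eq`).

Part (1): if γ is odd, the determinant δ of an inverting element lies in this subgroup, because δ^γ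
and δ^2 do, and the element can be corrected by a centralizing one. If all parts are even, d = 2 and
ω = -1 give det h = -e^2, since n/2 is odd; det h = 1 would make -1 a square, against q ≡ 3 mod 4.

Part (2): all-even types contribute no real classes. For any other type, each real class of GL_n
with determinant 1 splits into [Kˣ : (Kˣ)^γ] = h_ν classes of SL_n, all real by (1). The GL_n
classes correspond to families of monic self-reciprocal F_i of degree n_i. Each factor contributes a
sign to the determinant, and families with total sign 1 are counted as half of (number of all
families + sum of all signs) (`card_prod_sign_eq_one`, `slNu_eq_card_realFamily`). -/

/-! ### Ranks of polynomials acting on sums of cyclic modules. -/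

section PolynomialModule

open Polynomial Module

/-- The determinant of a product of endomorphisms. -/
theorem LinearMap.det_piMap {K ι : Type*} [Field K] [Fintype ι] {A : ι → Type*}
    [∀ i, AddCommGroup (A i)] [∀ i, Module K (A i)] [∀ i, FiniteDimensional K (A i)]
    (f : ∀ i, A i →ₗ[K] A i) :
    LinearMap.det (LinearMap.pi fun i => f i ∘ₗ LinearMap.proj i) = ∏ i, LinearMap.det (f i) := by
  let : LinearOrder ι := LinearOrder.lift' (Fintype.equivFin ι) (Fintype.equivFin ι).injective
  let b : ∀ i, Basis (Fin (finrank K (A i))) K (A i) := fun i => Module.finBasis K (A i)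
  rw [← LinearMap.det_toMatrix (Pi.basis b)]
  have heq : LinearMap.toMatrix (Pi.basis b) (Pi.basis b) (LinearMap.pi fun i => f i ∘ₗ LinearMap.proj i)
      = Matrix.blockDiagonal' fun i => LinearMap.toMatrix (b i) (b i) (f i) := by
    ext ⟨i, x⟩ ⟨j, y⟩
    rw [LinearMap.toMatrix_apply, Pi.basis_repr, Matrix.blockDiagonal'_apply]
    by_cases h : i = j
    · subst h
      simp [LinearMap.toMatrix_apply]
    · simp [h]
  rw [heq, (Matrix.blockTriangular_blockDiagonal' _).det_fintype]
  refine Finset.prod_congr rfl fun i _ => ?_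
  rw [← LinearMap.det_toMatrix (b i), ← Matrix.det_submatrix_equiv_self (Equiv.sigmaSubtype i).symm]
  congr 1
  ext x y
  simp [Matrix.toSquareBlock_def, Equiv.sigmaSubtype, Matrix.blockDiagonal'_apply]

variable {K : Type*} [Field K]

/-- Multiplication by a polynomial, as a `K`-linear endomorphism of a `K[X]`-module. -/
noncomputable def polySmul (M : Type*) [AddCommGroup M] [Module K M] [Module K[X] M]
    [IsScalarTower K K[X] M] (Q : K[X]) : M →ₗ[K] M :=
  Algebra.lsmul K K M Q

theorem polySmul_apply (M : Type*) [AddCommGroup M] [Module K M] [Module K[X] M]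
    [IsScalarTower K K[X] M] (Q : K[X]) (m : M) : polySmul M Q m = Q • m := rfl

theorem finrank_range_polySmul_congr {M N : Type*} [AddCommGroup M] [Module K M] [Module K[X] M]
    [IsScalarTower K K[X] M] [AddCommGroup N] [Module K N] [Module K[X] N]
    [IsScalarTower K K[X] N] (e : M ≃ₗ[K[X]] N) (Q : K[X]) :
    finrank K (LinearMap.range (polySmul M Q)) = finrank K (LinearMap.range (polySmul N Q)) := by
  have : LinearMap.range (polySmul N Q)
      = (LinearMap.range (polySmul M Q)).map (e.restrictScalars K : M →ₗ[K] N) := by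
    ext x
    simp only [LinearMap.mem_range, Submodule.mem_map, polySmul_apply]
    constructor
    · rintro ⟨y, rfl⟩
      exact ⟨_, ⟨e.symm y, rfl⟩, by simp⟩
    · rintro ⟨_, ⟨y, rfl⟩, rfl⟩
      exact ⟨e y, by simp⟩
  rw [this]
  exact (LinearEquiv.finrank_map_eq (e.restrictScalars K) _).symm

/-- The cokernel of `Q` on K[X]/(f) is K[X]/(f, Q), and the ideal (f, Q) is generated by the gcd. -/
theorem finrank_quotient_range_polySmul [DecidableEq K] (f Q : K[X]) :
    finrank K ((K[X] ⧸ Ideal.span {f}) ⧸ LinearMap.range (polySmul (K[X] ⧸ Ideal.span {f}) Q))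
      = (gcd f Q).natDegree := by
  have h1 : LinearMap.range (polySmul (K[X] ⧸ Ideal.span {f}) Q) =
      ((Ideal.span {Q}).map (Ideal.Quotient.mkₐ K (Ideal.span {f}))).restrictScalars K := by
    ext x
    rw [Ideal.map_span, Set.image_singleton]
    simp only [LinearMap.mem_range, polySmul_apply, Submodule.restrictScalars_mem,
      Ideal.mem_span_singleton']
    refine exists_congr fun a => ?_
    rw [mul_comm]; exact Iff.of_eq (congrArg (· = x) (Submodule.Quotient.induction_on _ a fun _ => rfl))
  rw [h1]
  have h2 := (DoubleQuot.quotQuotEquivQuotSupₐ K (Ideal.span {f}) (Ideal.span {Q})).toLinearEquiv.finrank_eq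
  rw [← Ideal.span_insert, ← span_gcd, finrank_quotient_span_eq_natDegree] at h2
  exact h2

theorem finrank_range_polySmul_pi {ι : Type*} [Fintype ι] [DecidableEq K] (f : ι → K[X])
    (hf : ∀ j, f j ≠ 0) (Q : K[X]) :
    finrank K (LinearMap.range (polySmul (∀ j, K[X] ⧸ Ideal.span {f j}) Q)) +
      ∑ j, (gcd (f j) Q).natDegree = ∑ j, (f j).natDegree := by
  classical
  have hfin : ∀ j, FiniteDimensional K (K[X] ⧸ Ideal.span {f j}) := fun j =>
    (AdjoinRoot.powerBasis (hf j)).finite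
  have h := Submodule.finrank_quotient_add_finrank
    (LinearMap.range (polySmul (∀ j, K[X] ⧸ Ideal.span {f j}) Q))
  have h1 : LinearMap.range (polySmul (∀ j, K[X] ⧸ Ideal.span {f j}) Q) =
      Submodule.pi Set.univ fun j => LinearMap.range (polySmul (K[X] ⧸ Ideal.span {f j}) Q) := by
    ext x
    simp only [LinearMap.mem_range, polySmul_apply, Submodule.mem_pi, Set.mem_univ, true_imp_iff]
    constructor
    · rintro ⟨y, rfl⟩ j
      exact ⟨y j, rfl⟩
    · intro hx
      choose y hy using hx
      exact ⟨y, funext hy⟩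
  have h2 : finrank K ((∀ j, K[X] ⧸ Ideal.span {f j}) ⧸
      LinearMap.range (polySmul (∀ j, K[X] ⧸ Ideal.span {f j}) Q)) =
      ∑ j, (gcd (f j) Q).natDegree := by
    rw [h1]
    have hfree : ∀ j, Module.Free K ((K[X] ⧸ Ideal.span {f j}) ⧸
        LinearMap.range (polySmul (K[X] ⧸ Ideal.span {f j}) Q)) := fun j =>
      Module.Free.of_divisionRing K _
    refine (((Submodule.quotientPi _).finrank_eq).trans (Module.finrank_pi_fintype K)).trans ?_
    exact Finset.sum_congr rfl fun j _ => finrank_quotient_range_polySmul _ _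
  rw [h2, Module.finrank_pi_fintype] at h
  simp only [finrank_quotient_span_eq_natDegree] at h
  omega

theorem natDegree_gcd_pow [DecidableEq K] {p u : K[X]} (hi : Irreducible p) (hu : ¬ p ∣ u)
    (a k : ℕ) : (gcd (p ^ a) (p ^ k * u)).natDegree = p.natDegree * min a k := by
  have hc : IsCoprime p u := (hi.coprime_iff_not_dvd).2 hu
  have : Associated (gcd (p ^ a) (p ^ k * u)) (p ^ min a k) := by
    apply associated_of_dvd_dvd
    · have h1 : gcd (p ^ a) (p ^ k * u) ∣ p ^ k := by
        apply IsCoprime.dvd_of_dvd_mul_right (z := u)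
        · exact IsCoprime.of_isCoprime_of_dvd_left (hc.pow_left (m := a)) (gcd_dvd_left _ _)
        · exact gcd_dvd_right _ _
      rcases le_total a k with h | h
      · rw [min_eq_left h]; exact gcd_dvd_left _ _
      · rw [min_eq_right h]; exact h1
    · exact dvd_gcd (pow_dvd_pow _ (min_le_left _ _))
        ((pow_dvd_pow _ (min_le_right _ _)).mul_right _)
  rw [natDegree_eq_of_degree_eq (degree_eq_degree_of_associated this), natDegree_pow, mul_comm]

end PolynomialModule

/-! ### Determinants along the image filtration of a nilpotent map. -/

section DetFiltration

open Module

variable {K V : Type*} [Field K] [AddCommGroup V] [Module K V]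

theorem LinearMap.det_eq_det_ker_mul_det {A B : Type*} [AddCommGroup A] [Module K A]
    [FiniteDimensional K A] [AddCommGroup B] [Module K B] [FiniteDimensional K B]
    (φ : A →ₗ[K] B) (hφ : Function.Surjective φ) (f : A →ₗ[K] A) (f' : B →ₗ[K] B)
    (h : φ ∘ₗ f = f' ∘ₗ φ) (hk : ∀ x ∈ LinearMap.ker φ, f x ∈ LinearMap.ker φ) :
    LinearMap.det f = LinearMap.det (f.restrict hk) * LinearMap.det f' := by
  rw [LinearMap.det_eq_det_mul_det (LinearMap.ker φ) f hk,
    ← LinearMap.det_conj ((LinearMap.ker φ).mapQ _ f hk) (φ.quotKerEquivOfSurjective hφ)]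
  congr 2
  ext x
  obtain ⟨y, rfl⟩ := (φ.quotKerEquivOfSurjective hφ).surjective x
  obtain ⟨z, rfl⟩ := Submodule.Quotient.mk_surjective _ y
  simpa using LinearMap.congr_fun h z

open Classical in
/-- The determinant of the restriction of `h` to `W`, if `W` is invariant under `h`. -/
noncomputable def detOn (h : V →ₗ[K] V) (W : Submodule K V) : K :=
  if hW : ∀ x ∈ W, h x ∈ W then LinearMap.det (h.restrict hW) else 1

theorem detOn_of_invariant (h : V →ₗ[K] V) (W : Submodule K V) (hW : ∀ x ∈ W, h x ∈ W) :
    detOn h W = LinearMap.det (h.restrict hW) := dif_pos hW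

theorem detOn_top (h : V →ₗ[K] V) : detOn h ⊤ = LinearMap.det h := by
  rw [detOn_of_invariant h ⊤ (fun _ _ => trivial),
    ← LinearMap.det_conj _ (Submodule.topEquiv : (⊤ : Submodule K V) ≃ₗ[K] V)]
  congr 1

theorem detOn_bot (h : V →ₗ[K] V) : detOn h ⊥ = 1 := by
  rw [detOn_of_invariant h ⊥ (by simp)]
  exact LinearMap.det_eq_one_of_subsingleton _

theorem invariant_range_pow {N h : V →ₗ[K] V} {ω : K} (hN : ∀ x, h (N x) = ω • N (h x)) (k : ℕ) :
    ∀ x ∈ LinearMap.range (N ^ k), h x ∈ LinearMap.range (N ^ k) := by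
  induction k with
  | zero => intro x _; exact ⟨h x, rfl⟩
  | succ k ih =>
    rintro _ ⟨y, rfl⟩
    obtain ⟨z, hz⟩ := ih _ ⟨y, rfl⟩
    rw [pow_succ', Module.End.mul_apply, hN, ← hz]
    exact ⟨ω • z, map_smul _ _ _⟩

theorem range_pow_succ_le (N : V →ₗ[K] V) (k : ℕ) :
    LinearMap.range (N ^ (k + 1)) ≤ LinearMap.range (N ^ k) := by
  rintro _ ⟨y, rfl⟩
  exact ⟨N y, by rw [pow_succ, Module.End.mul_apply]⟩

/-- The map `N^k V → N^{k+1} V` induced by `N`. -/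
def rangePowMap (N : V →ₗ[K] V) (k : ℕ) :
    LinearMap.range (N ^ k) →ₗ[K] LinearMap.range (N ^ (k + 1)) :=
  N.restrict (by
    rintro _ ⟨y, rfl⟩
    exact ⟨y, by rw [pow_succ', Module.End.mul_apply]⟩)

theorem rangePowMap_surjective (N : V →ₗ[K] V) (k : ℕ) :
    Function.Surjective (rangePowMap N k) := by
  rintro ⟨_, y, rfl⟩
  exact ⟨⟨(N ^ k) y, y, rfl⟩,
    Subtype.ext (LinearMap.congr_fun (pow_succ' N k) y).symm⟩

/-- The kernel of the map `N^k V → N^{k+1} V` as a subspace of `V`. -/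
def kerRangePowMapEquiv (N : V →ₗ[K] V) (k : ℕ) :
    LinearMap.ker (rangePowMap N k) ≃ₗ[K]
      (LinearMap.range (N ^ k) ⊓ LinearMap.ker N : Submodule K V) where
  toFun x := ⟨x.1.1, x.1.2, congrArg Subtype.val x.2⟩
  map_add' _ _ := rfl
  map_smul' _ _ := rfl
  invFun x := ⟨⟨x.1, x.2.1⟩, Subtype.ext x.2.2⟩
  left_inv _ := rfl
  right_inv _ := rfl

variable [FiniteDimensional K V]

theorem finrank_range_inf_ker (N : V →ₗ[K] V) (k : ℕ) :
    finrank K (LinearMap.range (N ^ (k + 1))) +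
      finrank K (LinearMap.range (N ^ k) ⊓ LinearMap.ker N : Submodule K V) =
      finrank K (LinearMap.range (N ^ k)) := by
  rw [← (kerRangePowMapEquiv N k).finrank_eq,
    ← LinearMap.finrank_range_add_finrank_ker (rangePowMap N k),
    LinearMap.range_eq_top.2 (rangePowMap_surjective N k), finrank_top]

/-- `N` maps N^k V onto N^(k+1) V with kernel N^k V ∩ ker N, and carries `h` on the source to ω • h
on the target. The power of ω is the determinant of that scalar. -/
theorem detOn_range_pow {N h : V →ₗ[K] V} {ω : K} (hω : ω * ω = 1)
    (hN : ∀ x, h (N x) = ω • N (h x)) (k : ℕ) :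
    detOn h (LinearMap.range (N ^ k)) = detOn h (LinearMap.range (N ^ k) ⊓ LinearMap.ker N) *
      ω ^ finrank K (LinearMap.range (N ^ (k + 1))) * detOn h (LinearMap.range (N ^ (k + 1))) := by
  have hN' : ∀ x, N (h x) = ω • h (N x) := fun x => by rw [hN, smul_smul, hω, one_smul]
  have hZ : ∀ x ∈ (LinearMap.range (N ^ k) ⊓ LinearMap.ker N : Submodule K V),
      h x ∈ (LinearMap.range (N ^ k) ⊓ LinearMap.ker N : Submodule K V) := by
    rintro x ⟨hx, hx'⟩
    refine ⟨invariant_range_pow hN k x hx, ?_⟩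
    have hx'' : N x = 0 := hx'
    change N (h x) = 0
    rw [hN', hx'', map_zero, smul_zero]
  have hker : ∀ x ∈ LinearMap.ker (rangePowMap N k),
      (h.restrict (invariant_range_pow hN k)) x ∈ LinearMap.ker (rangePowMap N k) := by
    intro x hx
    have hx' : N x.1 = 0 := congrArg Subtype.val hx
    refine Subtype.ext ?_
    change N (h x.1) = 0
    rw [hN', hx', map_zero, smul_zero]
  rw [detOn_of_invariant h _ (invariant_range_pow hN k),
    detOn_of_invariant h _ (invariant_range_pow hN (k + 1)), detOn_of_invariant h _ hZ, mul_assoc,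
    ← LinearMap.det_smul,
    LinearMap.det_eq_det_ker_mul_det (rangePowMap N k) (rangePowMap_surjective N k)
      (h.restrict (invariant_range_pow hN k)) (ω • h.restrict (invariant_range_pow hN (k + 1)))
      (by ext x; exact hN' x.1) hker,
    ← LinearMap.det_conj _ (kerRangePowMapEquiv N k)]
  rfl

theorem det_eq_prod_detOn {N h : V →ₗ[K] V} {ω : K} (hω : ω * ω = 1)
    (hN : ∀ x, h (N x) = ω • N (h x)) (m : ℕ) :
    LinearMap.det h = (∏ k ∈ Finset.range m, detOn h (LinearMap.range (N ^ k) ⊓ LinearMap.ker N)) *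
      ω ^ (∑ k ∈ Finset.range m, finrank K (LinearMap.range (N ^ (k + 1)))) *
      detOn h (LinearMap.range (N ^ m)) := by
  induction m with
  | zero =>
    have : LinearMap.range (N ^ 0) = ⊤ := LinearMap.range_eq_top.2 fun x => ⟨x, rfl⟩
    rw [this]
    simp [detOn_top]
  | succ m ih =>
    rw [ih, detOn_range_pow hω hN m, Finset.prod_range_succ, Finset.sum_range_succ, pow_add]
    ring

theorem Finset.prod_range_mul_of_const {E : ℕ → K} {d : ℕ}
    (hE : ∀ k, ¬ d ∣ k + 1 → E (k + 1) = E k) (L : ℕ) :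
    ∏ k ∈ Finset.range (L * d), E k = (∏ m ∈ Finset.range L, E (m * d)) ^ d := by
  induction L with
  | zero => simp
  | succ L ih =>
    rw [add_mul, one_mul, Finset.prod_range_add, ih, Finset.prod_range_succ, mul_pow]
    congr 1
    rw [Finset.prod_eq_pow_card (b := E (L * d)), Finset.card_range]
    intro x hx
    rw [Finset.mem_range] at hx
    induction x with
    | zero => rfl
    | succ x ihx =>
      rw [← ihx (by omega), ← add_assoc]
      refine hE _ fun hd => ?_
      rw [add_assoc] at hd
      have := Nat.le_of_dvd (by omega) ((Nat.dvd_add_right (dvd_mul_left d L)).1 hd)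
      omega

/-- If the Jordan blocks of the nilpotent `N` have sizes divisible by `d`, and `h` commutes with `N`
up to a sign `ω`, then `det h` is a `d`-th power up to an explicit power of `ω`. -/
theorem exists_det_eq_pow_mul {N h : V →ₗ[K] V} {ω : K} (hω : ω * ω = 1)
    (hN : ∀ x, h (N x) = ω • N (h x)) {d L : ℕ} (hnil : N ^ (L * d) = 0)
    (hd : ∀ k, ¬ d ∣ k + 1 → finrank K (LinearMap.range (N ^ k)) +
      finrank K (LinearMap.range (N ^ (k + 2))) = 2 * finrank K (LinearMap.range (N ^ (k + 1)))) :
    ∃ e : K, LinearMap.det h =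
      e ^ d * ω ^ (∑ k ∈ Finset.range (L * d), finrank K (LinearMap.range (N ^ (k + 1)))) := by
  -- One determinant for each run of d equal spaces N^k V ∩ ker N.
  refine ⟨∏ m ∈ Finset.range L, detOn h (LinearMap.range (N ^ (m * d)) ⊓ LinearMap.ker N), ?_⟩
  rw [det_eq_prod_detOn hω hN (L * d), hnil, LinearMap.range_zero, detOn_bot, mul_one,
    Finset.prod_range_mul_of_const
      (E := fun k => detOn h (LinearMap.range (N ^ k) ⊓ LinearMap.ker N))]
  intro k hk
  congr 1
  apply Submodule.eq_of_le_of_finrank_eq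
  · exact inf_le_inf_right _ (range_pow_succ_le N k)
  -- By rank-nullity, dim(N^k V ∩ ker N) is a first difference of ranks; `hd` says that two
  -- consecutive differences agree.
  · have h1 := finrank_range_inf_ker N k
    have h2 := finrank_range_inf_ker N (k + 1)
    have h3 := hd k hk
    rw [show k + 1 + 1 = k + 2 from rfl] at h2
    omega

end DetFiltration

/-! ### Determinants of multiplication maps as norms. -/

section Norms

open Module Polynomial

variable {K : Type*} [Field K]

theorem LinearMap.det_eq_det_mul_det_of_exact {A B C : Type*} [AddCommGroup A] [Module K A]
    [FiniteDimensional K A] [AddCommGroup B] [Module K B] [FiniteDimensional K B]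
    [AddCommGroup C] [Module K C] [FiniteDimensional K C]
    (ψ : A →ₗ[K] B) (φ : B →ₗ[K] C) (hψ : Function.Injective ψ) (hφ : Function.Surjective φ)
    (hex : Function.Exact ψ φ) (a : A →ₗ[K] A) (b : B →ₗ[K] B) (c : C →ₗ[K] C)
    (hab : ∀ x, ψ (a x) = b (ψ x)) (hbc : ∀ x, φ (b x) = c (φ x)) :
    LinearMap.det b = LinearMap.det a * LinearMap.det c := by
  have hk : ∀ x ∈ LinearMap.ker φ, b x ∈ LinearMap.ker φ := fun x hx => by
    rw [LinearMap.mem_ker] at hx ⊢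
    rw [hbc, hx, map_zero]
  rw [LinearMap.det_eq_det_ker_mul_det φ hφ b c (LinearMap.ext hbc) hk]
  congr 1
  let e : A ≃ₗ[K] LinearMap.ker φ := (LinearEquiv.ofInjective ψ hψ).trans
    (LinearEquiv.ofEq _ _ hex.linearMap_ker_eq.symm)
  rw [← LinearMap.det_conj a e]
  congr 1
  ext x
  obtain ⟨y, rfl⟩ := e.surjective x
  have : e.symm (e y) = y := e.symm_apply_apply y
  simp only [LinearMap.coe_comp, LinearEquiv.coe_coe, Function.comp_apply, this]
  exact (hab y).symm

theorem finiteDimensional_quotient_span {f : K[X]} (hf : f ≠ 0) :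
    FiniteDimensional K (K[X] ⧸ Ideal.span {f}) :=
  (AdjoinRoot.powerBasis hf).finite

/-- Determinants are multiplicative along 0 → K[X]/(f₁) → K[X]/(f₁f₂) → K[X]/(f₂) → 0, where the
first map is multiplication by f₂. -/
theorem det_polySmul_mul {f₁ f₂ : K[X]} (h₁ : f₁ ≠ 0) (h₂ : f₂ ≠ 0) (Q : K[X]) :
    LinearMap.det (polySmul (K[X] ⧸ Ideal.span {f₁ * f₂}) Q) =
      LinearMap.det (polySmul (K[X] ⧸ Ideal.span {f₁}) Q) *
        LinearMap.det (polySmul (K[X] ⧸ Ideal.span {f₂}) Q) := by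
  have := finiteDimensional_quotient_span h₁
  have := finiteDimensional_quotient_span h₂
  have := finiteDimensional_quotient_span (mul_ne_zero h₁ h₂)
  let ψ : (K[X] ⧸ Ideal.span {f₁}) →ₗ[K[X]] (K[X] ⧸ Ideal.span {f₁ * f₂}) :=
    Submodule.mapQ _ _ (LinearMap.mulLeft K[X] f₂) (by
      intro x hx
      rw [Ideal.mem_span_singleton] at hx
      rw [Submodule.mem_comap, LinearMap.mulLeft_apply, Ideal.mem_span_singleton, mul_comm f₁]
      exact mul_dvd_mul_left _ hx)
  let φ : (K[X] ⧸ Ideal.span {f₁ * f₂}) →ₗ[K[X]] (K[X] ⧸ Ideal.span {f₂}) :=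
    Submodule.mapQ _ _ LinearMap.id (by
      intro x hx
      rw [Ideal.mem_span_singleton] at hx
      rw [Submodule.mem_comap, LinearMap.id_apply, Ideal.mem_span_singleton]
      exact (dvd_mul_left _ _).trans hx)
  refine LinearMap.det_eq_det_mul_det_of_exact (ψ.restrictScalars K) (φ.restrictScalars K)
    ?_ ?_ ?_ _ _ _ (fun x => map_smul ψ Q x) (fun x => map_smul φ Q x)
  · refine (injective_iff_map_eq_zero ψ).2 fun x => ?_
    obtain ⟨x, rfl⟩ := Submodule.Quotient.mk_surjective _ x
    intro hx
    have hx' : f₂ * x ∈ Ideal.span {f₁ * f₂} := (Submodule.Quotient.mk_eq_zero _).1 hx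
    rw [Ideal.mem_span_singleton, mul_comm f₁] at hx'
    exact (Submodule.Quotient.mk_eq_zero _).2
      (Ideal.mem_span_singleton.2 ((mul_dvd_mul_iff_left h₂).1 hx'))
  · intro x
    obtain ⟨x, rfl⟩ := Submodule.Quotient.mk_surjective _ x
    exact ⟨Submodule.Quotient.mk x, rfl⟩
  · intro x
    obtain ⟨x, rfl⟩ := Submodule.Quotient.mk_surjective _ x
    constructor
    · intro hx
      have hx' : x ∈ Ideal.span {f₂} := (Submodule.Quotient.mk_eq_zero _).1 hx
      obtain ⟨y, rfl⟩ := Ideal.mem_span_singleton.1 hx'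
      exact ⟨Submodule.Quotient.mk y, rfl⟩
    · rintro ⟨y, hy⟩
      rw [← hy]
      obtain ⟨y, rfl⟩ := Submodule.Quotient.mk_surjective _ y
      exact (Submodule.Quotient.mk_eq_zero _).2
        (Ideal.mem_span_singleton.2 (dvd_mul_right _ _))

theorem det_polySmul_pow {f : K[X]} (hf : f ≠ 0) (a : ℕ) (Q : K[X]) :
    LinearMap.det (polySmul (K[X] ⧸ Ideal.span {f ^ a}) Q) =
      LinearMap.det (polySmul (K[X] ⧸ Ideal.span {f}) Q) ^ a := by
  induction a with
  | zero =>
    have : Subsingleton (K[X] ⧸ Ideal.span {f ^ 0}) :=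
      Ideal.Quotient.subsingleton_iff.2 (by rw [pow_zero, Ideal.span_singleton_one])
    rw [LinearMap.det_eq_one_of_subsingleton, pow_zero]
  | succ a ih =>
    rw [pow_succ f, det_polySmul_mul (pow_ne_zero a hf) hf, ih, pow_succ]

theorem polySmul_one (M : Type*) [AddCommGroup M] [Module K M] [Module K[X] M]
    [IsScalarTower K K[X] M] : polySmul M (1 : K[X]) = LinearMap.id :=
  LinearMap.ext fun x => one_smul K[X] x

theorem det_polySmul_eq_norm (f Q : K[X]) :
    LinearMap.det (polySmul (K[X] ⧸ Ideal.span {f}) Q) =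
      Algebra.norm K (AdjoinRoot.mk f Q) := by
  have h : polySmul (K[X] ⧸ Ideal.span {f}) Q =
      Algebra.lmul K (K[X] ⧸ Ideal.span {f}) (Ideal.Quotient.mk _ Q) := by
    refine LinearMap.ext fun x => ?_
    obtain ⟨x, rfl⟩ := Ideal.Quotient.mk_surjective x
    rfl
  rw [h]
  exact (Algebra.norm_apply K (S := K[X] ⧸ Ideal.span {f}) (Ideal.Quotient.mk _ Q)).symm

theorem det_polySmul_X {f : K[X]} (hf : f.Monic) :
    LinearMap.det (polySmul (K[X] ⧸ Ideal.span {f}) X) = (-1) ^ f.natDegree * f.coeff 0 := by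
  have h := Algebra.PowerBasis.norm_gen_eq_coeff_zero_minpoly (AdjoinRoot.powerBasis hf.ne_zero)
  rw [AdjoinRoot.minpoly_powerBasis_gen_of_monic hf, AdjoinRoot.powerBasis_dim,
    AdjoinRoot.powerBasis_gen] at h
  rw [det_polySmul_eq_norm, AdjoinRoot.mk_X, h]

theorem det_polySmul_pi {ι : Type*} [Fintype ι] (f : ι → K[X]) (hf : ∀ j, f j ≠ 0) (Q : K[X]) :
    LinearMap.det (polySmul (∀ j, K[X] ⧸ Ideal.span {f j}) Q) =
      ∏ j, LinearMap.det (polySmul (K[X] ⧸ Ideal.span {f j}) Q) := by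
  have := fun j => finiteDimensional_quotient_span (hf j)
  rw [← LinearMap.det_piMap]
  rfl

theorem exists_det_polySmul_eq [Finite K] {p : K[X]} (hp : Irreducible p) (x : K) :
    ∃ Q : K[X], LinearMap.det (polySmul (K[X] ⧸ Ideal.span {p}) Q) = x := by
  have : Fact (Irreducible p) := ⟨hp⟩
  have : FiniteDimensional K (AdjoinRoot p) := finiteDimensional_quotient_span hp.ne_zero
  have : Finite (AdjoinRoot p) := Module.finite_of_finite K
  obtain ⟨y, hy⟩ := FiniteField.norm_surjective K (AdjoinRoot p) x
  obtain ⟨Q, rfl⟩ := AdjoinRoot.mk_surjective y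
  exact ⟨Q, by rw [det_polySmul_eq_norm, hy]⟩

/-- Over a finite field, every `x ^ a j₀` is the determinant of an endomorphism of
`∏ K[X] / (p_j ^ a_j)` commuting with `X`. -/
theorem exists_det_pi_eq_pow [Finite K] {ι : Type*} [Fintype ι] (p : ι → K[X])
    (hp : ∀ j, Irreducible (p j)) (a : ι → ℕ) (j₀ : ι) (x : K) :
    ∃ c : (∀ j, K[X] ⧸ Ideal.span {p j ^ a j}) →ₗ[K[X]] (∀ j, K[X] ⧸ Ideal.span {p j ^ a j}),
      LinearMap.det (c.restrictScalars K) = x ^ a j₀ := by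
  classical
  have := fun j => finiteDimensional_quotient_span (pow_ne_zero (a j) (hp j).ne_zero)
  obtain ⟨Q, hQ⟩ := exists_det_polySmul_eq (hp j₀) x
  -- Act by `Q` on the single summand `j₀` and trivially on all others.
  let q : ι → K[X] := fun j => if j = j₀ then Q else 1
  refine ⟨LinearMap.pi fun j => LinearMap.lsmul K[X] _ (q j) ∘ₗ LinearMap.proj j, ?_⟩
  have h : LinearMap.det ((LinearMap.pi fun j => (LinearMap.lsmul K[X] _ (q j) ∘ₗ LinearMap.proj j :
      (∀ j, K[X] ⧸ Ideal.span {p j ^ a j}) →ₗ[K[X]] _)).restrictScalars K) =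
      ∏ j, LinearMap.det (polySmul (K[X] ⧸ Ideal.span {p j ^ a j}) (q j)) := by
    rw [← LinearMap.det_piMap]
    rfl
  rw [h, Finset.prod_eq_single j₀]
  · rw [det_polySmul_pow (hp j₀).ne_zero, show q j₀ = Q from if_pos rfl, hQ]
  · intro j _ hj
    rw [show q j = 1 from if_neg hj, polySmul_one, LinearMap.det_id]
  · simp

end Norms

/-! ### Degree, determinant and centralizer in terms of the elementary divisors. -/

section ElementaryDivisors

open Module Polynomial

variable {K : Type*} [Field K] {n : ℕ}

theorem HasElementaryDivisors.nonempty_pi {g : GL (Fin n) K} {r : ℕ} {p : Fin r → K[X]}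
    {a : Fin r → ℕ} (h : HasElementaryDivisors g p a) :
    Nonempty (AEval' (Matrix.toLin' (g : Matrix (Fin n) (Fin n) K)) ≃ₗ[K[X]]
      ∀ j, K[X] ⧸ Ideal.span {p j ^ a j}) :=
  h.2.2.map fun e => e.trans (DirectSum.linearEquivFunOnFintype K[X] (Fin r) _)

theorem polySmul_aeval (φ : (Fin n → K) →ₗ[K] (Fin n → K)) (Q : K[X]) :
    polySmul (AEval' φ) Q = (AEval'.of φ).conj (aeval φ Q) := rfl

theorem finrank_range_polySmul_aeval (φ : (Fin n → K) →ₗ[K] (Fin n → K)) (Q : K[X]) :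
    finrank K (LinearMap.range (polySmul (AEval' φ) Q)) =
      finrank K (LinearMap.range (aeval φ Q)) := by
  have : LinearMap.range (polySmul (AEval' φ) Q) =
      (LinearMap.range (aeval φ Q)).map (AEval'.of φ : (Fin n → K) →ₗ[K] AEval' φ) := by
    ext x
    simp only [LinearMap.mem_range, Submodule.mem_map]
    constructor
    · rintro ⟨y, rfl⟩
      exact ⟨_, ⟨(AEval'.of φ).symm y, rfl⟩, rfl⟩
    · rintro ⟨_, ⟨y, rfl⟩, rfl⟩
      exact ⟨AEval'.of φ y, rfl⟩
  rw [this]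
  exact LinearEquiv.finrank_map_eq (AEval'.of φ) _

theorem HasElementaryDivisors.finrank_range_aeval [DecidableEq K] {g : GL (Fin n) K} {r : ℕ}
    {p : Fin r → K[X]} {a : Fin r → ℕ} (h : HasElementaryDivisors g p a) (Q : K[X]) :
    finrank K (LinearMap.range (aeval (Matrix.toLin' (g : Matrix (Fin n) (Fin n) K)) Q)) +
      ∑ j, (gcd (p j ^ a j) Q).natDegree = ∑ j, (p j ^ a j).natDegree := by
  obtain ⟨e⟩ := h.nonempty_pi
  rw [← finrank_range_polySmul_aeval, finrank_range_polySmul_congr e,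
    finrank_range_polySmul_pi _ fun j => pow_ne_zero _ (h.1 j).2.ne_zero]

theorem HasElementaryDivisors.sum_mul_natDegree {g : GL (Fin n) K} {r : ℕ}
    {p : Fin r → K[X]} {a : Fin r → ℕ} (h : HasElementaryDivisors g p a) :
    ∑ j, a j * (p j).natDegree = n := by
  classical
  have h1 := h.finrank_range_aeval 1
  rw [map_one, Module.End.one_eq_id, LinearMap.range_id, finrank_top, finrank_fin_fun] at h1
  simp only [gcd_one_right, natDegree_one, Finset.sum_const_zero, natDegree_pow] at h1
  omega

theorem HasElementaryDivisors.det_eq {g : GL (Fin n) K} {r : ℕ}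
    {p : Fin r → K[X]} {a : Fin r → ℕ} (h : HasElementaryDivisors g p a) :
    (g : Matrix (Fin n) (Fin n) K).det = ∏ j, ((-1) ^ (p j).natDegree * (p j).coeff 0) ^ a j := by
  obtain ⟨e⟩ := h.nonempty_pi
  have h1 : LinearMap.det (polySmul (∀ j, K[X] ⧸ Ideal.span {p j ^ a j}) (X : K[X])) =
      LinearMap.det (polySmul (AEval' (Matrix.toLin' (g : Matrix (Fin n) (Fin n) K))) X) := by
    rw [← LinearMap.det_conj _ (e.restrictScalars K)]
    congr 1
    refine LinearMap.ext fun x => ?_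
    change (X : K[X]) • x = e ((X : K[X]) • e.symm x)
    rw [map_smul, LinearEquiv.apply_symm_apply]
  rw [← LinearMap.det_toLin']
  rw [polySmul_aeval, LinearEquiv.conj_apply, LinearMap.comp_assoc, LinearMap.det_conj, aeval_X] at h1
  rw [← h1, det_polySmul_pi _ fun j => pow_ne_zero _ (h.1 j).2.ne_zero]
  refine Finset.prod_congr rfl fun j _ => ?_
  rw [det_polySmul_pow (h.1 j).2.ne_zero, det_polySmul_X (h.1 j).1]

theorem HasElementaryDivisors.exists_commute_det_eq_pow [Finite K] {g : GL (Fin n) K} {r : ℕ}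
    {p : Fin r → K[X]} {a : Fin r → ℕ} (h : HasElementaryDivisors g p a) (j : Fin r) (x : Kˣ) :
    ∃ c : GL (Fin n) K, c * g = g * c ∧ Matrix.GeneralLinearGroup.det c = x ^ a j := by
  obtain ⟨e⟩ := h.nonempty_pi
  obtain ⟨c, hc⟩ := exists_det_pi_eq_pow p (fun j => (h.1 j).2) a j (x : K)
  let φ := Matrix.toLin' (g : Matrix (Fin n) (Fin n) K)
  let c₁ : AEval' φ →ₗ[K[X]] AEval' φ := e.symm.toLinearMap ∘ₗ c ∘ₗ e.toLinearMap
  let c₂ : (Fin n → K) →ₗ[K] (Fin n → K) :=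
    (AEval'.of φ).symm.toLinearMap ∘ₗ c₁.restrictScalars K ∘ₗ (AEval'.of φ).toLinearMap
  have hdet : LinearMap.det c₂ = (x : K) ^ a j := by
    rw [← hc, ← LinearMap.det_conj (c.restrictScalars K)
      ((e.restrictScalars K).symm.trans (AEval'.of φ).symm)]
    rfl
  have hcomm : c₂ ∘ₗ φ = φ ∘ₗ c₂ := by
    refine LinearMap.ext fun y => ?_
    have : c₁ (AEval'.of φ (φ y)) = (X : K[X]) • c₁ (AEval'.of φ y) := by
      rw [← map_smul]
      congr 1
      exact (AEval.X_smul_of φ y).symm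
    change (AEval'.of φ).symm (c₁ (AEval'.of φ (φ y))) = φ ((AEval'.of φ).symm (c₁ (AEval'.of φ y)))
    rw [this]
    exact AEval.of_symm_X_smul φ _
  have hdet' : (LinearMap.toMatrix' c₂).det = (x : K) ^ a j := by
    rw [LinearMap.det_toMatrix', hdet]
  refine ⟨Matrix.GeneralLinearGroup.mkOfDetNeZero (LinearMap.toMatrix' c₂)
    (by rw [hdet']; exact pow_ne_zero _ x.ne_zero), ?_, ?_⟩
  · ext1
    have := congrArg LinearMap.toMatrix' hcomm
    rw [LinearMap.toMatrix'_comp, LinearMap.toMatrix'_comp, LinearMap.toMatrix'_toLin'] at this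
    simpa [Matrix.GeneralLinearGroup.mkOfDetNeZero] using this
  · ext
    simpa [Matrix.GeneralLinearGroup.mkOfDetNeZero] using hdet'

/-- `F i` is the product of the `p_j` with `a_j = i`, for the elementary divisors `p_j ^ a_j`
of `g`. -/
def HasDivisorFamily (g : GL (Fin n) K) (F : ℕ → K[X]) : Prop :=
  ∃ (r : ℕ) (p : Fin r → K[X]) (a : Fin r → ℕ), HasElementaryDivisors g p a ∧
    ∀ i, F i = ∏ j : Fin r with a j = i, p j

theorem hasPartitionType_iff {g : GL (Fin n) K} {ν : n.Partition} :
    HasPartitionType g ν ↔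
      ∃ F, HasDivisorFamily g F ∧ ∀ i, ν.parts.count i = (F i).natDegree := by
  constructor
  · rintro ⟨r, p, a, h, hν⟩
    exact ⟨_, ⟨r, p, a, h, fun _ => rfl⟩, hν⟩
  · rintro ⟨F, ⟨r, p, a, h, hF⟩, hν⟩
    exact ⟨r, p, a, h, fun i => by rw [hν, hF]⟩

theorem HasElementaryDivisors.le {g : GL (Fin n) K} {r : ℕ}
    {p : Fin r → K[X]} {a : Fin r → ℕ} (h : HasElementaryDivisors g p a) (j : Fin r) : a j ≤ n := by
  rw [← h.sum_mul_natDegree]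
  calc a j ≤ a j * (p j).natDegree := Nat.le_mul_of_pos_right _ (h.1 j).2.natDegree_pos
    _ ≤ _ := Finset.single_le_sum (f := fun j => a j * (p j).natDegree) (fun _ _ => Nat.zero_le _)
      (Finset.mem_univ j)

theorem HasElementaryDivisors.sum_fiberwise {M : Type*} [AddCommMonoid M] {g : GL (Fin n) K} {r : ℕ}
    {p : Fin r → K[X]} {a : Fin r → ℕ} (h : HasElementaryDivisors g p a) (w : Fin r → M) :
    ∑ j, w j = ∑ i ∈ Finset.range (n + 1), ∑ j with a j = i, w j :=
  (Finset.sum_fiberwise_of_maps_to (fun j _ => Finset.mem_range.2 (Nat.lt_succ_of_le (h.le j))) _).symm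

theorem HasElementaryDivisors.sum_natDegree_mul {g : GL (Fin n) K} {r : ℕ}
    {p : Fin r → K[X]} {a : Fin r → ℕ} (h : HasElementaryDivisors g p a) {F : ℕ → K[X]}
    (hF : ∀ i, F i = ∏ j : Fin r with a j = i, p j) (w : ℕ → ℕ) :
    ∑ j, (p j).natDegree * w (a j) =
      ∑ i ∈ Finset.range (n + 1), (F i).natDegree * w i := by
  rw [h.sum_fiberwise]
  refine Finset.sum_congr rfl fun i _ => ?_
  rw [hF, natDegree_prod _ _ fun j _ => (h.1 j).2.ne_zero, Finset.sum_mul]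
  refine Finset.sum_congr rfl fun j hj => ?_
  rw [(Finset.mem_filter.1 hj).2]

theorem HasDivisorFamily.sum_mul_natDegree {g : GL (Fin n) K} {F : ℕ → K[X]}
    (h : HasDivisorFamily g F) :
    ∑ i ∈ Finset.range (n + 1), (F i).natDegree * i = n := by
  obtain ⟨r, p, a, h, hF⟩ := h
  rw [← h.sum_natDegree_mul hF fun i => i, ← h.sum_mul_natDegree]
  simp only [mul_comm]

theorem HasDivisorFamily.det_eq {g : GL (Fin n) K} {F : ℕ → K[X]} (h : HasDivisorFamily g F) :
    (g : Matrix (Fin n) (Fin n) K).det =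
      ∏ i ∈ Finset.range (n + 1), ((-1) ^ (F i).natDegree * (F i).coeff 0) ^ i := by
  obtain ⟨r, p, a, h, hF⟩ := h
  rw [h.det_eq, ← Finset.prod_fiberwise_of_maps_to
    (fun j _ => Finset.mem_range.2 (Nat.lt_succ_of_le (h.le j)))]
  refine Finset.prod_congr rfl fun i _ => ?_
  rw [hF, natDegree_prod _ _ fun j _ => (h.1 j).2.ne_zero, ← Finset.prod_pow_eq_pow_sum,
    coeff_zero_eq_eval_zero, eval_prod, ← Finset.prod_mul_distrib, ← Finset.prod_pow]
  refine Finset.prod_congr rfl fun j hj => ?_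
  rw [(Finset.mem_filter.1 hj).2, coeff_zero_eq_eval_zero]

theorem HasDivisorFamily.monic {g : GL (Fin n) K} {F : ℕ → K[X]} (h : HasDivisorFamily g F)
    (i : ℕ) : (F i).Monic := by
  obtain ⟨r, p, a, h, hF⟩ := h
  rw [hF]
  exact monic_prod_of_monic _ _ fun j _ => (h.1 j).1

theorem HasDivisorFamily.zero {g : GL (Fin n) K} {F : ℕ → K[X]} (h : HasDivisorFamily g F) :
    F 0 = 1 := by
  obtain ⟨r, p, a, h, hF⟩ := h
  rw [hF, Finset.filter_false_of_mem fun j _ => (h.2.1 j).ne', Finset.prod_empty]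

theorem HasDivisorFamily.eq_one_of_lt {g : GL (Fin n) K} {F : ℕ → K[X]} (h : HasDivisorFamily g F)
    {i : ℕ} (hi : n < i) : F i = 1 := by
  obtain ⟨r, p, a, h, hF⟩ := h
  rw [hF, Finset.filter_false_of_mem fun j _ => ((h.le j).trans_lt hi).ne, Finset.prod_empty]

/-- Each F_i(0) with 1 ≤ i ≤ n is, up to sign, a base in the product formula for det g, which is
nonzero; all other F_i are 1. -/
theorem HasDivisorFamily.coeff_zero_ne_zero {g : GL (Fin n) K} {F : ℕ → K[X]}
    (h : HasDivisorFamily g F) (i : ℕ) : (F i).coeff 0 ≠ 0 := by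
  by_cases hi : n < i
  · simp [h.eq_one_of_lt hi]
  by_cases hi0 : i = 0
  · simp [hi0, h.zero]
  have hdet : (g : Matrix (Fin n) (Fin n) K).det ≠ 0 :=
    (Matrix.GeneralLinearGroup.det g).ne_zero
  rw [h.det_eq, Finset.prod_ne_zero_iff] at hdet
  have := hdet i (by simp; omega)
  rw [pow_ne_zero_iff hi0] at this
  exact right_ne_zero_of_mul this

end ElementaryDivisors

/-! ### The nilpotent element g^b - g^(-b). -/

section NilpotentPart

open Module Polynomial

variable {K : Type*} [Field K] {n : ℕ}

/-- `Q` annihilates the module, in particular the vector whose components are all 1. -/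
theorem HasElementaryDivisors.dvd_of_aeval_eq_zero {g : GL (Fin n) K} {r : ℕ}
    {p : Fin r → K[X]} {a : Fin r → ℕ} (h : HasElementaryDivisors g p a) {Q : K[X]}
    (hQ : aeval (Matrix.toLin' (g : Matrix (Fin n) (Fin n) K)) Q = 0) (j : Fin r) :
    p j ^ a j ∣ Q := by
  obtain ⟨e⟩ := h.nonempty_pi
  have h0 : ∀ m : AEval' (Matrix.toLin' (g : Matrix (Fin n) (Fin n) K)), Q • m = 0 := fun m => by
    change polySmul _ Q m = 0
    rw [polySmul_aeval, hQ, map_zero, LinearMap.zero_apply]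
  let one : ∀ j, K[X] ⧸ Ideal.span {p j ^ a j} := fun j => Submodule.Quotient.mk 1
  have h1 : Q • one = 0 := by
    rw [← e.apply_symm_apply one, ← map_smul, h0, map_zero]
  have h2 : Submodule.Quotient.mk (Q • (1 : K[X])) = (0 : K[X] ⧸ Ideal.span {p j ^ a j}) :=
    congrFun h1 j
  rw [Submodule.Quotient.mk_eq_zero, smul_eq_mul, mul_one] at h2
  exact Ideal.mem_span_singleton.1 h2

/-- Write the order of `g` as c^e b with c the characteristic and c ∤ b. Then (X^b - 1)^(c^e)
annihilates `g`, so every irreducible p_j divides X^b - 1. -/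
theorem HasElementaryDivisors.exists_dvd_X_pow_sub_one [Finite K] {g : GL (Fin n) K} {r : ℕ}
    {p : Fin r → K[X]} {a : Fin r → ℕ} (h : HasElementaryDivisors g p a) :
    ∃ b : ℕ, (b : K) ≠ 0 ∧ ∀ j, p j ∣ X ^ b - 1 := by
  obtain ⟨c, hc⟩ := CharP.exists K
  have hcp : Fact c.Prime := ⟨CharP.char_is_prime K c⟩
  obtain ⟨e, b, hb, hN⟩ := Nat.exists_eq_pow_mul_and_not_dvd (orderOf_pos g).ne' c hcp.out.ne_one
  refine ⟨b, fun h0 => hb ((CharP.cast_eq_zero_iff K c b).1 h0), fun j => ?_⟩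
  have h1 : aeval (Matrix.toLin' (g : Matrix (Fin n) (Fin n) K)) ((X ^ b - 1 : K[X]) ^ c ^ e) = 0 := by
    rw [sub_pow_char_pow, one_pow, ← pow_mul, mul_comm b, ← hN, map_sub, map_pow, aeval_X, map_one,
      ← Matrix.toLin'_pow, ← Units.val_pow_eq_pow_val, pow_orderOf_eq_one, Units.val_one,
      Matrix.toLin'_one, Module.End.one_eq_id, sub_self]
  exact (h.1 j).2.prime.dvd_of_dvd_pow
    ((dvd_pow_self _ (h.2.1 j).ne').trans (h.dvd_of_aeval_eq_zero h1 j))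

theorem rank_aeval (g : Matrix (Fin n) (Fin n) K) (Q : K[X]) :
    (aeval g Q).rank = finrank K (LinearMap.range (aeval (Matrix.toLin' g) Q)) := by
  have : aeval (Matrix.toLin' g) Q = Matrix.toLin' (aeval g Q) :=
    aeval_algHom_apply (Matrix.toLinAlgEquiv' (R := K) (n := Fin n)).toAlgHom g Q
  rw [this, Matrix.rank, Matrix.toLin'_apply']

/-- Since g^b - g^(-b) = g^(-b)(g^(2b) - 1), the ranks are those of powers of X^(2b) - 1 at `g`.
This polynomial is separable because 2b ≠ 0 in `K`, so each p_j divides it exactly once. The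
difference is used rather than g^b - 1 because inverting `g` negates it. -/
theorem HasDivisorFamily.exists_rank_add [Finite K] (h2 : (2 : K) ≠ 0) {g : GL (Fin n) K}
    {F : ℕ → K[X]} (h : HasDivisorFamily g F) :
    ∃ b : ℕ, ∀ k, (((g ^ b : GL (Fin n) K) - (g⁻¹ ^ b : GL (Fin n) K) :
      Matrix (Fin n) (Fin n) K) ^ k).rank +
        ∑ i ∈ Finset.range (n + 1), (F i).natDegree * min i k = n := by
  classical
  obtain ⟨r, p, a, h, hF⟩ := h
  obtain ⟨b, hb, hdvd⟩ := h.exists_dvd_X_pow_sub_one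
  refine ⟨b, fun k => ?_⟩
  let R : K[X] := X ^ (b * 2) - 1
  have hsep : R.Separable := X_pow_sub_one_separable_iff.2 (by push_cast; exact mul_ne_zero hb h2)
  have hrank : (((g ^ b : GL (Fin n) K) - (g⁻¹ ^ b : GL (Fin n) K) :
      Matrix (Fin n) (Fin n) K) ^ k).rank = (aeval (g : Matrix (Fin n) (Fin n) K) (R ^ k)).rank := by
    have h1 : ((g ^ b : GL (Fin n) K) - (g⁻¹ ^ b : GL (Fin n) K) : Matrix (Fin n) (Fin n) K) =
        (g⁻¹ ^ b : GL (Fin n) K) * aeval (g : Matrix (Fin n) (Fin n) K) R := by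
      simp only [R, map_sub, map_pow, aeval_X, map_one, mul_sub, mul_one]
      rw [← Units.val_pow_eq_pow_val, ← Units.val_mul]
      congr 3
      group
    have hc : Commute ((g⁻¹ ^ b : GL (Fin n) K) : Matrix (Fin n) (Fin n) K)
        (aeval (g : Matrix (Fin n) (Fin n) K) R) := by
      simp only [R, map_sub, map_pow, aeval_X, map_one]
      refine Commute.sub_right ?_ (Commute.one_right _)
      rw [Units.val_pow_eq_pow_val]
      refine Commute.pow_pow ?_ _ _
      change _ = _
      rw [← Units.val_mul, ← Units.val_mul, inv_mul_cancel, mul_inv_cancel]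
    rw [h1, hc.mul_pow, ← Units.val_pow_eq_pow_val, map_pow]
    exact Matrix.rank_mul_eq_right_of_isUnit_det _ _ (Matrix.isUnits_det_units _)
  rw [hrank, rank_aeval]
  have h3 := h.finrank_range_aeval (R ^ k)
  have h4 : ∀ j, (gcd (p j ^ a j) (R ^ k)).natDegree = (p j).natDegree * min (a j) k := fun j => by
    obtain ⟨u, hu⟩ : p j ∣ R := (hdvd j).trans (by
      simp only [R, pow_mul]
      simpa using sub_dvd_pow_sub_pow (X ^ b : K[X]) 1 2)
    rw [hu, mul_pow]
    refine natDegree_gcd_pow (h.1 j).2 (fun hd => ?_) _ _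
    obtain ⟨v, rfl⟩ := (h.1 j).2.prime.dvd_of_dvd_pow hd
    exact (h.1 j).2.not_isUnit (hsep.squarefree _ ⟨v, by rw [hu, mul_assoc]⟩)
  have h5 := h.sum_mul_natDegree
  simp only [h4, natDegree_pow, h5] at h3
  rw [← h.sum_natDegree_mul hF fun i => min i k]
  exact h3

theorem sum_sub_succ (i m : ℕ) (h : i ≤ m) :
    (∑ k ∈ Finset.range m, (i - (k + 1))) * 2 = i * (i - 1) := by
  rw [← Finset.sum_range_id_mul_two]
  congr 1
  rw [← Finset.sum_range_reflect (fun k => k) i, ← Finset.sum_subset (Finset.range_mono h)]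
  · exact Finset.sum_congr rfl fun k hk => by omega
  · intro k _ hk
    rw [Finset.mem_range] at hk
    omega

/-- If all Jordan blocks of `g` have sizes divisible by `d`, the determinant of an element that
centralizes or inverts `g` is a `d`-th power up to an explicit sign. -/
theorem HasDivisorFamily.exists_det_eq [Finite K] (h2 : (2 : K) ≠ 0) {g : GL (Fin n) K}
    {F : ℕ → K[X]} (h : HasDivisorFamily g F) {d : ℕ} (hd : 0 < d)
    (hF : ∀ i, ¬ d ∣ i → (F i).natDegree = 0) {x : GL (Fin n) K} {ω : K} (hω : ω * ω = 1)
    (hx : ∀ b : ℕ, (x : Matrix (Fin n) (Fin n) K) *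
      ((g ^ b : GL (Fin n) K) - (g⁻¹ ^ b : GL (Fin n) K) : Matrix (Fin n) (Fin n) K) =
        ω • (((g ^ b : GL (Fin n) K) - (g⁻¹ ^ b : GL (Fin n) K) : Matrix (Fin n) (Fin n) K) * x)) :
    ∃ e : K, (x : Matrix (Fin n) (Fin n) K).det =
      e ^ d * ω ^ (∑ i ∈ Finset.range (n + 1), (F i).natDegree * (i * (i - 1) / 2)) := by
  obtain ⟨b, hb⟩ := h.exists_rank_add h2
  replace hx := hx b
  set A : Matrix (Fin n) (Fin n) K :=
    (g ^ b : GL (Fin n) K) - (g⁻¹ ^ b : GL (Fin n) K) with hA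
  have hn := h.sum_mul_natDegree
  have hρ : ∀ k, finrank K (LinearMap.range (Matrix.toLin' A ^ k)) =
      ∑ i ∈ Finset.range (n + 1), (F i).natDegree * (i - k) := fun k => by
    have h1 := hb k
    have h3 : (∑ i ∈ Finset.range (n + 1), (F i).natDegree * (i - k)) +
        ∑ i ∈ Finset.range (n + 1), (F i).natDegree * min i k = n := by
      rw [← Finset.sum_add_distrib]
      refine (Finset.sum_congr rfl fun i _ => ?_).trans hn
      rw [← mul_add]
      congr 1
      omega
    rw [← Matrix.toLin'_pow, Matrix.toLin'_apply']
    rw [Matrix.rank] at h1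
    omega
  -- Exponent n already suffices; n * d makes the filtration a whole number of runs of length d.
  have hnil : Matrix.toLin' A ^ (n * d) = 0 := by
    have h1 := hρ (n * d)
    rw [Finset.sum_eq_zero] at h1
    · exact LinearMap.range_eq_bot.1 (Submodule.finrank_eq_zero.1 h1)
    · intro i hi
      have : n ≤ n * d := Nat.le_mul_of_pos_right _ hd
      rw [Finset.mem_range] at hi
      rw [Nat.sub_eq_zero_of_le (by omega), mul_zero]
  obtain ⟨e, he⟩ := exists_det_eq_pow_mul (N := Matrix.toLin' A)
    (h := Matrix.toLin' (x : Matrix (Fin n) (Fin n) K)) hω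
    (fun y => by
      rw [← LinearMap.comp_apply, ← Matrix.toLin'_mul, hx, map_smul, Matrix.toLin'_mul]
      rfl) hnil (fun k hk => by
      rw [hρ, hρ, hρ, ← Finset.sum_add_distrib, Finset.mul_sum]
      refine Finset.sum_congr rfl fun i _ => ?_
      -- The truncated difference i - k is affine near k + 1 except when i = k + 1, and there F_i
      -- has degree 0 because d ∤ i.
      by_cases hi : i = k + 1
      · subst hi
        rw [hF _ hk]
        simp
      · rw [← mul_add, mul_left_comm]
        congr 1
        omega)
  refine ⟨e, ?_⟩
  rw [← LinearMap.det_toLin', he]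
  congr 2
  simp only [hρ]
  rw [Finset.sum_comm]
  refine Finset.sum_congr rfl fun i hi => ?_
  rw [← Finset.mul_sum]
  congr 1
  have h1 : n ≤ n * d := Nat.le_mul_of_pos_right _ hd
  rw [Finset.mem_range] at hi
  have := sum_sub_succ i (n * d) (by omega)
  omega

end NilpotentPart

/-! ### Determinants of the centralizer, and reality in SL_n. -/

section RealInSpecialLinear

open Module Polynomial

variable {K : Type*} [Field K] {n : ℕ}

theorem HasPartitionType.mem_parts_iff {ν : n.Partition} {F : ℕ → K[X]}
    (hν : ∀ i, ν.parts.count i = (F i).natDegree) (i : ℕ) :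
    i ∈ ν.parts ↔ (F i).natDegree ≠ 0 := by
  rw [← hν, Multiset.count_ne_zero]

/-- The determinants of the elements that centralize `g`. -/
def detCentralizer (g : GL (Fin n) K) : Subgroup Kˣ :=
  (Subgroup.centralizer {g}).map Matrix.GeneralLinearGroup.det

theorem mem_detCentralizer {g : GL (Fin n) K} {x : Kˣ} :
    x ∈ detCentralizer g ↔
      ∃ c : GL (Fin n) K, c * g = g * c ∧ Matrix.GeneralLinearGroup.det c = x := by
  simp [detCentralizer, Subgroup.mem_map, Subgroup.mem_centralizer_singleton_iff]

theorem HasDivisorFamily.pow_mem_detCentralizer [Finite K] {g : GL (Fin n) K} {F : ℕ → K[X]}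
    (h : HasDivisorFamily g F) {i : ℕ} (hi : (F i).natDegree ≠ 0) (x : Kˣ) :
    x ^ i ∈ detCentralizer g := by
  obtain ⟨r, p, a, h, hF⟩ := h
  have : ∃ j, a j = i := by
    by_contra! hne
    rw [hF, Finset.filter_false_of_mem fun j _ => hne j] at hi
    simp at hi
  obtain ⟨j, rfl⟩ := this
  exact mem_detCentralizer.2 (h.exists_commute_det_eq_pow j x)

theorem Subgroup.pow_multiset_gcd_mem {G : Type*} [CommGroup G] (S : Subgroup G) (x : G)
    (s : Multiset ℕ) (h : ∀ i ∈ s, x ^ i ∈ S) : x ^ s.gcd ∈ S := by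
  induction s using Multiset.induction with
  | empty => simp
  | cons a s ih =>
    have h1 := h a (Multiset.mem_cons_self a s)
    have h2 := ih fun i hi => h i (Multiset.mem_cons_of_mem hi)
    rw [Multiset.gcd_cons, ← zpow_natCast]
    change x ^ ((Nat.gcd a s.gcd : ℕ) : ℤ) ∈ S
    rw [Nat.gcd_eq_gcd_ab, zpow_add, zpow_mul, zpow_mul, zpow_natCast, zpow_natCast]
    exact S.mul_mem (S.zpow_mem h1 _) (S.zpow_mem h2 _)

theorem Nat.Partition.gcd_pos (ν : n.Partition) (hn : n ≠ 0) : 0 < ν.parts.gcd := by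
  rw [Nat.pos_iff_ne_zero, Ne, Multiset.gcd_eq_zero_iff]
  intro h
  apply hn
  rw [← ν.parts_sum]
  exact Multiset.sum_eq_zero h

/-- One inclusion is the filtration argument with d the gcd and ω = 1. The other combines the i-th
powers, for all parts i, by Bézout. -/
theorem HasDivisorFamily.detCentralizer_eq [Finite K] (h2 : (2 : K) ≠ 0) (hn : n ≠ 0)
    {g : GL (Fin n) K} {F : ℕ → K[X]} (h : HasDivisorFamily g F) {ν : n.Partition}
    (hν : ∀ i, ν.parts.count i = (F i).natDegree) :
    detCentralizer g = (powMonoidHom ν.parts.gcd : Kˣ →* Kˣ).range := by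
  apply le_antisymm
  · intro x hx
    obtain ⟨c, hc, rfl⟩ := mem_detCentralizer.1 hx
    have hd := ν.gcd_pos hn
    obtain ⟨e, he⟩ := h.exists_det_eq h2 hd (fun i hi => by
      by_contra h0
      exact hi (Multiset.gcd_dvd ((HasPartitionType.mem_parts_iff hν i).2 h0))) (x := c)
      (ω := 1) (mul_one 1) (fun b => by
        rw [one_smul, mul_sub, sub_mul]
        have hcg : Commute c g := hc
        simp only [← Units.val_mul]
        rw [(hcg.pow_right b).eq, (hcg.inv_right.pow_right b).eq])
    rw [one_pow, mul_one] at he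
    have he0 : e ≠ 0 := by
      rintro rfl
      rw [zero_pow hd.ne'] at he
      exact (Matrix.GeneralLinearGroup.det c).ne_zero he
    exact ⟨Units.mk0 e he0, Units.ext he.symm⟩
  · rintro _ ⟨x, rfl⟩
    exact Subgroup.pow_multiset_gcd_mem _ _ _ fun i hi =>
      h.pow_mem_detCentralizer ((HasPartitionType.mem_parts_iff hν i).1 hi) x

theorem exists_toGL_eq {y : GL (Fin n) K} (hy : Matrix.GeneralLinearGroup.det y = 1) :
    ∃ s : SL(n, K), Matrix.SpecialLinearGroup.toGL s = y :=
  ⟨⟨y, congrArg Units.val hy⟩, Units.ext rfl⟩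

theorem isRealElement_iff_exists_odd [Finite K] (hn : n ≡ 2 [MOD 4]) (hq : Nat.card K ≡ 3 [MOD 4])
    {g : SL(n, K)} {F : ℕ → K[X]}
    (h : HasDivisorFamily (Matrix.SpecialLinearGroup.toGL g) F) {ν : n.Partition}
    (hν : ∀ i, ν.parts.count i = (F i).natDegree)
    (hg : IsRealElement (Matrix.SpecialLinearGroup.toGL g)) :
    IsRealElement g ↔ ∃ i : ℕ, Odd i ∧ 0 < ν.parts.count i := by
  have := Fintype.ofFinite K
  rw [Nat.card_eq_fintype_card] at hq
  have hsq : ¬ IsSquare (-1 : K) := fun hs => FiniteField.isSquare_neg_one_iff.1 hs hq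
  have h2 : (2 : K) ≠ 0 := fun h0 => hsq ⟨1, by linear_combination -h0⟩
  have hn0 : n ≠ 0 := by
    rintro rfl
    exact absurd hn (by decide)
  constructor
  · rintro ⟨x, hx⟩
    by_contra! hodd
    have hF : ∀ i, ¬ 2 ∣ i → (F i).natDegree = 0 := fun i hi => by
      have := hodd i (Nat.not_even_iff_odd.1 fun he => hi he.two_dvd)
      rw [hν] at this
      omega
    set G := Matrix.SpecialLinearGroup.toGL g with hG
    set Y := Matrix.SpecialLinearGroup.toGL x with hY
    have hYG : Y * G * Y⁻¹ = G⁻¹ := by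
      rw [hG, hY, ← map_inv, ← map_mul, ← map_inv, ← map_mul, hx]
    have hb : ∀ b : ℕ, Y * G ^ b = G⁻¹ ^ b * Y := fun b => by
      rw [← hYG, conj_pow]
      group
    have hb' : ∀ b : ℕ, Y * G⁻¹ ^ b = G ^ b * Y := fun b => by
      have : Y * G⁻¹ * Y⁻¹ = G := by rw [← conj_inv, hYG, inv_inv]
      conv_rhs => rw [← this, conj_pow]
      group
    obtain ⟨e, he⟩ := h.exists_det_eq h2 two_pos hF (x := Y) (ω := -1) (by ring) (fun b => by
      rw [mul_sub, sub_mul]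
      simp only [← Units.val_mul]
      rw [hb, hb', neg_smul, one_smul, neg_sub])
    have hdet : (Y : Matrix (Fin n) (Fin n) K).det = 1 := x.2
    -- For i = 2t one has i(i-1)/2 + i/2 = 2t², so modulo 2 the exponent equals Σ n_i i/2 = n/2,
    -- which is odd.
    have hpar : Odd (∑ i ∈ Finset.range (n + 1), (F i).natDegree * (i * (i - 1) / 2)) := by
      have hsum : ∑ i ∈ Finset.range (n + 1), (F i).natDegree * (i * (i - 1) / 2) +
          ∑ i ∈ Finset.range (n + 1), (F i).natDegree * (i / 2) =
          2 * ∑ i ∈ Finset.range (n + 1), (F i).natDegree * ((i / 2) * (i / 2)) := by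
        rw [← Finset.sum_add_distrib, Finset.mul_sum]
        refine Finset.sum_congr rfl fun i _ => ?_
        by_cases hi : 2 ∣ i
        · obtain ⟨t, rfl⟩ := hi
          rw [mul_assoc, Nat.mul_div_cancel_left _ two_pos, Nat.mul_div_cancel_left _ two_pos]
          rcases t with _ | t
          · simp
          · rw [show 2 * (t + 1) - 1 = 2 * t + 1 by omega]
            ring
        · rw [hF i hi]
          simp
      have hhalf : 2 * ∑ i ∈ Finset.range (n + 1), (F i).natDegree * (i / 2) = n := by
        rw [← h.sum_mul_natDegree, Finset.mul_sum]
        refine Finset.sum_congr (by rw [h.sum_mul_natDegree]) fun i _ => ?_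
        by_cases hi : 2 ∣ i
        · obtain ⟨t, rfl⟩ := hi
          rw [Nat.mul_div_cancel_left _ two_pos]
          ring
        · rw [hF i hi]
          simp
      have hn' : n % 4 = 2 := hn
      rw [Nat.odd_iff]
      omega
    rw [hdet, hpar.neg_one_pow] at he
    have he0 : e ≠ 0 := by
      rintro rfl
      norm_num at he
    -- Here 1 = -e², so e⁻¹ is a square root of -1.
    exact hsq ⟨e⁻¹, by field_simp; linear_combination -he⟩
  · rintro ⟨i, hi, hi0⟩
    obtain ⟨y, hy⟩ := hg
    set G := Matrix.SpecialLinearGroup.toGL g with hG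
    have hodd : Odd ν.parts.gcd :=
      Odd.of_dvd_nat hi (Multiset.gcd_dvd (Multiset.count_pos.1 hi0))
    obtain ⟨m, hm⟩ := hodd
    set δ := Matrix.GeneralLinearGroup.det y with hδ
    have h3 : δ ^ ν.parts.gcd ∈ detCentralizer G := by
      rw [h.detCentralizer_eq h2 hn0 hν]
      exact ⟨δ, rfl⟩
    -- The square of an inverting element centralizes.
    have h4 : δ ^ 2 ∈ detCentralizer G := by
      refine mem_detCentralizer.2 ⟨y ^ 2, ?_, by rw [map_pow]⟩
      have h5 : y * G = G⁻¹ * y := mul_inv_eq_iff_eq_mul.1 hy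
      have h6 : y * G⁻¹ = G * y :=
        mul_inv_eq_iff_eq_mul.1 (by rw [← conj_inv, hy, inv_inv])
      rw [pow_two, mul_assoc, h5, ← mul_assoc, h6, mul_assoc]
    have h5 : δ ∈ detCentralizer G := by
      -- The gcd is 2m + 1.
      have : δ = δ ^ ν.parts.gcd * ((δ ^ 2) ^ m)⁻¹ := by
        rw [hm, ← pow_mul, pow_succ]
        group
      rw [this]
      exact Subgroup.mul_mem _ h3 (Subgroup.inv_mem _ (Subgroup.pow_mem _ h4 _))
    obtain ⟨c, hc, hcdet⟩ := mem_detCentralizer.1 h5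
    have hdet : Matrix.GeneralLinearGroup.det (y * c⁻¹) = 1 := by
      rw [map_mul, map_inv, hcdet, mul_inv_cancel]
    obtain ⟨s, hs⟩ := exists_toGL_eq hdet
    refine ⟨s, Matrix.SpecialLinearGroup.toGL_injective ?_⟩
    rw [map_mul, map_mul, map_inv, map_inv, ← hG, hs, ← hy]
    have h7 : c⁻¹ * G * c = G := by rw [mul_assoc, ← hc, inv_mul_cancel_left]
    calc y * c⁻¹ * G * (y * c⁻¹)⁻¹ = y * (c⁻¹ * G * c) * y⁻¹ := by group
      _ = _ := by rw [h7]

end RealInSpecialLinear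

/-! ### Reciprocal polynomials and their factorization. -/

section ReciprocalPolynomial

open Polynomial UniqueFactorizationMonoid

variable {K : Type*} [Field K]

/-- The monic polynomial whose nonzero roots are the inverses of those of `f`. -/
noncomputable def starPoly (f : K[X]) : K[X] := C f.mirror.leadingCoeff⁻¹ * f.mirror

theorem starPoly_mul (f g : K[X]) : starPoly (f * g) = starPoly f * starPoly g := by
  rw [starPoly, starPoly, starPoly, mirror_mul_of_domain, leadingCoeff_mul, mul_inv, C_mul]
  ring

theorem starPoly_one : starPoly (1 : K[X]) = 1 := by
  rw [starPoly, ← C_1, mirror_C, leadingCoeff_C, inv_one, ← C_mul, one_mul]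

theorem starPoly_monic {f : K[X]} (hf : f ≠ 0) : (starPoly f).Monic := by
  rw [starPoly, Monic, leadingCoeff_mul, leadingCoeff_C, inv_mul_cancel₀]
  exact leadingCoeff_ne_zero.2 fun h => hf (mirror_eq_zero.1 h)

theorem starPoly_associated (f : K[X]) : Associated (starPoly f) f.mirror := by
  by_cases hf : f.mirror = 0
  · simp [starPoly, hf]
  · exact associated_unit_mul_left _ _
      (isUnit_C.2 (isUnit_iff_ne_zero.2 (inv_ne_zero (leadingCoeff_ne_zero.2 hf))))

theorem natDegree_starPoly (f : K[X]) : (starPoly f).natDegree = f.natDegree := by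
  rw [natDegree_eq_of_degree_eq (degree_eq_degree_of_associated (starPoly_associated f)),
    mirror_natDegree]

theorem starPoly_multiset_prod (s : Multiset K[X]) : starPoly s.prod = (s.map starPoly).prod :=
  map_multiset_prod (⟨⟨starPoly, starPoly_one⟩, starPoly_mul⟩ : K[X] →* K[X]) s

theorem Polynomial.mirror_associated {f g : K[X]} (h : Associated f g) :
    Associated f.mirror g.mirror :=
  h.map (⟨⟨mirror, by rw [← C_1, mirror_C]⟩, fun f g => mirror_mul_of_domain f g⟩ : K[X] →* K[X])

/-- Unlike `reverse`, `mirror` is an involution also on polynomials with zero constant term, so no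
condition on f(0) is needed. -/
theorem starPoly_starPoly {f : K[X]} (hf : f.Monic) : starPoly (starPoly f) = f := by
  refine eq_of_monic_of_associated (starPoly_monic (starPoly_monic hf.ne_zero).ne_zero) hf ?_
  have h := (starPoly_associated (starPoly f)).trans (mirror_associated (starPoly_associated f))
  rwa [mirror_mirror] at h

theorem starPoly_irreducible {p : K[X]} (hp : Irreducible p) : Irreducible (starPoly p) := by
  rw [(starPoly_associated p).irreducible_iff]
  let e : K[X] ≃* K[X] :=
    ⟨⟨mirror, mirror, fun f => f.mirror_mirror, fun f => f.mirror_mirror⟩, fun f g => mirror_mul_of_domain f g⟩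
  exact (MulEquiv.irreducible_iff e).2 hp

theorem mirror_eq_reverse {f : K[X]} (hf : f.coeff 0 ≠ 0) : f.mirror = f.reverse := by
  rw [mirror, natTrailingDegree_eq_zero.2 (Or.inr hf), pow_zero, mul_one]

theorem starPoly_eq {f : K[X]} (hf : f.coeff 0 ≠ 0) :
    starPoly f = C (f.coeff 0)⁻¹ * f.reverse := by
  rw [starPoly, mirror_eq_reverse hf, reverse_leadingCoeff, trailingCoeff,
    natTrailingDegree_eq_zero.2 (Or.inr hf)]

theorem starPoly_map {L : Type*} [Field L] (i : K →+* L) {f : K[X]} (hf : f.coeff 0 ≠ 0) :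
    starPoly (f.map i) = (starPoly f).map i := by
  rw [starPoly_eq hf, starPoly_eq (by rwa [coeff_map, Ne, map_eq_zero]), Polynomial.map_mul, map_C,
    map_inv₀ i, coeff_map, reverse, reverse, natDegree_map, reflect_map]

theorem starPoly_X_sub_C {α : K} (hα : α ≠ 0) : starPoly (X - C α) = X - C α⁻¹ := by
  have h0 : (X - C α).coeff 0 ≠ 0 := by simpa using hα
  rw [starPoly_eq h0, sub_eq_add_neg, ← C_neg, reverse_add_C]
  have h1 : (X : K[X]).reverse = 1 := by
    have := reverse_X_mul (1 : K[X])
    rwa [mul_one, ← C_1, reverse_C] at this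
  simp only [coeff_add, coeff_X_zero, coeff_C_zero, zero_add, h1, natDegree_X, pow_one, mul_add,
    mul_one, ← mul_assoc, ← C_mul]
  rw [inv_mul_cancel₀ (neg_ne_zero.2 hα), C_1, one_mul, inv_neg, C_neg]
  ring

/-- Over the algebraic closure, `starPoly` replaces each factor X - α by X - α⁻¹; a monic polynomial
is determined by its roots there. -/
theorem isSelfReciprocal_iff {f : K[X]} (hf : f.Monic) (h0 : f.coeff 0 ≠ 0) :
    IsSelfReciprocal f ↔ starPoly f = f := by
  set L := AlgebraicClosure K
  have hm : (f.map (algebraMap K L)).Monic := hf.map _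
  have h1 : f.map (algebraMap K L) = ((f.aroots L).map fun α => X - C α).prod :=
    (IsAlgClosed.splits _).eq_prod_roots_of_monic hm
  have h2 : (starPoly f).map (algebraMap K L) =
      (((f.aroots L).map fun α => α⁻¹).map fun α => X - C α).prod := by
    rw [← starPoly_map _ h0, h1, starPoly_multiset_prod, Multiset.map_map, Multiset.map_map]
    congr 1
    refine Multiset.map_congr rfl fun α hα => ?_
    refine starPoly_X_sub_C ?_
    rintro rfl
    rw [mem_aroots, aeval_def, eval₂_at_zero, map_eq_zero] at hα
    exact h0 hα.2
  unfold IsSelfReciprocal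
  constructor
  · intro h
    rw [h, ← h1] at h2
    exact map_injective _ (algebraMap K L).injective h2
  · intro h
    rw [h, h1] at h2
    have := congrArg roots h2
    rw [roots_multiset_prod_X_sub_C, roots_multiset_prod_X_sub_C] at this
    exact this.symm

theorem normalizedFactors_prod_of_monic_irreducible [DecidableEq K] {s : Multiset K[X]}
    (hs : ∀ p ∈ s, Irreducible p ∧ p.Monic) : normalizedFactors s.prod = s := by
  rw [normalizedFactors_prod_eq s fun p hp => (hs p hp).1]
  exact (Multiset.map_congr rfl fun p hp => (hs p hp).2.normalize_eq_self).trans s.map_id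

theorem irreducible_monic_of_mem [DecidableEq K] {f p : K[X]} (hp : p ∈ normalizedFactors f) :
    Irreducible p ∧ p.Monic :=
  ⟨irreducible_of_normalized_factor p hp, by
    rw [← normalize_normalized_factor p hp]
    exact monic_normalize (irreducible_of_normalized_factor p hp).ne_zero⟩

theorem prod_normalizedFactors_of_monic [DecidableEq K] {f : K[X]} (hf : f.Monic) :
    (normalizedFactors f).prod = f := by
  rw [prod_normalizedFactors_eq hf.ne_zero, hf.normalize_eq_self]

theorem normalizedFactors_starPoly [DecidableEq K] {f : K[X]} (hf : f.Monic) :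
    normalizedFactors (starPoly f) = (normalizedFactors f).map starPoly := by
  conv_lhs => rw [← prod_normalizedFactors_of_monic hf]
  rw [starPoly_multiset_prod, normalizedFactors_prod_of_monic_irreducible]
  intro p hp
  obtain ⟨q, hq, rfl⟩ := Multiset.mem_map.1 hp
  have := irreducible_monic_of_mem hq
  exact ⟨starPoly_irreducible this.1, starPoly_monic this.2.ne_zero⟩

theorem count_normalizedFactors_starPoly [DecidableEq K] {f p : K[X]} (hf : f.Monic)
    (hp : p.Monic) :
    (normalizedFactors (starPoly f)).count p = (normalizedFactors f).count (starPoly p) := by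
  rw [normalizedFactors_starPoly hf]
  rw [Multiset.count_map, Multiset.count, Multiset.countP_eq_card_filter]
  congr 1
  refine Multiset.filter_congr fun q hq => ⟨fun h => ?_, fun h => ?_⟩
  · rw [h, starPoly_starPoly (irreducible_monic_of_mem hq).2]
  · rw [← h, starPoly_starPoly hp]

end ReciprocalPolynomial

/-! ### Uniqueness of the divisor family, and the family of the inverse. -/

section Classification

open Module Polynomial UniqueFactorizationMonoid

variable {K : Type*} [Field K] {n : ℕ}

theorem HasElementaryDivisors.normalizedFactors_eq [DecidableEq K] {g : GL (Fin n) K} {r : ℕ}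
    {p : Fin r → K[X]} {a : Fin r → ℕ} (h : HasElementaryDivisors g p a) (i : ℕ) :
    normalizedFactors (∏ j : Fin r with a j = i, p j) =
      (Finset.univ.filter fun j => a j = i).val.map p := by
  rw [Finset.prod_eq_multiset_prod, normalizedFactors_prod_of_monic_irreducible]
  intro q hq
  obtain ⟨j, _, rfl⟩ := Multiset.mem_map.1 hq
  exact (h.1 j).symm

theorem HasElementaryDivisors.count_eq [DecidableEq K] {g : GL (Fin n) K} {r : ℕ}
    {p : Fin r → K[X]} {a : Fin r → ℕ} (h : HasElementaryDivisors g p a) (i : ℕ) (P : K[X]) :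
    (normalizedFactors (∏ j : Fin r with a j = i, p j)).count P =
      (Finset.univ.filter fun j => a j = i ∧ p j = P).card := by
  rw [h.normalizedFactors_eq, Multiset.count_map, ← Finset.filter_filter, Finset.card_def,
    Finset.filter_val (fun j => p j = P)]
  congr 1
  exact Multiset.filter_congr fun _ _ => eq_comm

theorem natDegree_gcd_pow_pow [DecidableEq K] {p P : K[X]} (hp : p.Monic ∧ Irreducible p)
    (hP : P.Monic ∧ Irreducible P) (a k : ℕ) :
    (gcd (p ^ a) (P ^ k)).natDegree = if p = P then P.natDegree * min a k else 0 := by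
  split_ifs with h
  · subst h
    simpa using natDegree_gcd_pow (u := 1) hp.2
      (fun hd => hp.2.not_isUnit (isUnit_of_dvd_one hd)) a k
  · have := natDegree_gcd_pow (u := P ^ k) hp.2 (fun hd => h (eq_of_monic_of_associated hp.1 hP.1
      ((hp.2.dvd_irreducible_iff_associated hP.2).1 (hp.2.prime.dvd_of_dvd_pow hd)))) a 0
    simpa using this

/-- The ranks of P(g)^k are conjugation invariants from which the multiplicity of `P` in every F_i
can be recovered. -/
theorem HasDivisorFamily.rank_add [DecidableEq K] {g : GL (Fin n) K} {F : ℕ → K[X]}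
    (h : HasDivisorFamily g F) {P : K[X]} (hP : Irreducible P) (hm : P.Monic) (k : ℕ) :
    (aeval (g : Matrix (Fin n) (Fin n) K) (P ^ k)).rank +
      P.natDegree * ∑ i ∈ Finset.range (n + 1), (normalizedFactors (F i)).count P * min i k = n := by
  obtain ⟨r, p, a, h, hF⟩ := h
  have h1 := h.finrank_range_aeval (P ^ k)
  have h2 := h.sum_mul_natDegree
  simp only [natDegree_pow, h2] at h1
  rw [rank_aeval]
  convert h1 using 2
  rw [h.sum_fiberwise, Finset.mul_sum]
  refine Finset.sum_congr rfl fun i _ => ?_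
  rw [hF, h.count_eq, Finset.card_filter, Finset.sum_mul, Finset.mul_sum, Finset.sum_filter]
  refine Finset.sum_congr rfl fun j _ => ?_
  by_cases hj : a j = i
  · rw [if_pos hj, natDegree_gcd_pow_pow (h.1 j) ⟨hm, hP⟩, hj]
    by_cases hp : p j = P
    · rw [if_pos hp, if_pos ⟨rfl, hp⟩, one_mul]
    · rw [if_neg hp, if_neg fun hh => hp hh.2, zero_mul, mul_zero]
  · rw [if_neg hj, if_neg fun hh => hj hh.1, zero_mul, mul_zero]

/-- The second difference of k ↦ min i k is nonzero only at k = i, so it isolates the coefficient c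
i. -/
theorem eq_of_sum_mul_min_eq {c c' : ℕ → ℕ} {d : ℕ}
    (h : ∀ k, ∑ i ∈ Finset.range (d + 1), c i * min i k =
      ∑ i ∈ Finset.range (d + 1), c' i * min i k) {i : ℕ} (hi : i ≠ 0) (hid : i ≤ d) :
    c i = c' i := by
  obtain ⟨k, rfl⟩ := Nat.exists_eq_succ_of_ne_zero hi
  have key : ∀ c : ℕ → ℕ, 2 * ∑ i ∈ Finset.range (d + 1), c i * min i (k + 1) =
      (∑ i ∈ Finset.range (d + 1), c i * min i k) +
        (∑ i ∈ Finset.range (d + 1), c i * min i (k + 2)) + c (k + 1) := fun c => by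
    have : c (k + 1) = ∑ i ∈ Finset.range (d + 1), if i = k + 1 then c i else 0 := by
      rw [Finset.sum_ite_eq', if_pos (Finset.mem_range.2 (by omega))]
    rw [this, ← Finset.sum_add_distrib, ← Finset.sum_add_distrib, Finset.mul_sum]
    refine Finset.sum_congr rfl fun i _ => ?_
    split_ifs with hik
    · subst hik
      rw [min_eq_left le_rfl, min_eq_right (by omega), min_eq_left (by omega)]
      ring
    · rw [add_zero, ← mul_add, mul_left_comm]
      congr 1
      omega
  have h1 := key c
  have h2 := key c'
  rw [h, h, h] at h1
  exact Nat.add_left_cancel (h1.symm.trans h2)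

theorem HasDivisorFamily.count_eq_of_rank_eq [DecidableEq K] {g g' : GL (Fin n) K}
    {F F' : ℕ → K[X]} (h : HasDivisorFamily g F) (h' : HasDivisorFamily g' F') {P P' : K[X]}
    (hP : Irreducible P) (hm : P.Monic) (hP' : Irreducible P') (hm' : P'.Monic)
    (hdeg : P.natDegree = P'.natDegree)
    (hr : ∀ k, (aeval (g : Matrix (Fin n) (Fin n) K) (P ^ k)).rank =
      (aeval (g' : Matrix (Fin n) (Fin n) K) (P' ^ k)).rank) (i : ℕ) :
    (normalizedFactors (F i)).count P = (normalizedFactors (F' i)).count P' := by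
  by_cases hi : i = 0
  · rw [hi, h.zero, h'.zero, normalizedFactors_one]
    simp
  by_cases hin : n < i
  · rw [h.eq_one_of_lt hin, h'.eq_one_of_lt hin, normalizedFactors_one]
    simp
  refine eq_of_sum_mul_min_eq (d := n) (c := fun i => (normalizedFactors (F i)).count P)
    (c' := fun i => (normalizedFactors (F' i)).count P') (fun k => ?_) hi (not_lt.1 hin)
  have h1 := h.rank_add hP hm k
  have h2 := h'.rank_add hP' hm' k
  rw [hr, hdeg] at h1
  exact Nat.eq_of_mul_eq_mul_left hP'.natDegree_pos (by omega)

theorem eq_of_count_normalizedFactors_eq [DecidableEq K] {f f' : K[X]} (hf : f.Monic)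
    (hf' : f'.Monic) (h : ∀ P : K[X], Irreducible P → P.Monic →
      (normalizedFactors f).count P = (normalizedFactors f').count P) : f = f' := by
  rw [← prod_normalizedFactors_of_monic hf, ← prod_normalizedFactors_of_monic hf']
  congr 1
  ext P
  by_cases hP : Irreducible P ∧ P.Monic
  · exact h P hP.1 hP.2
  · rw [Multiset.count_eq_zero_of_notMem fun hm => hP (irreducible_monic_of_mem hm),
      Multiset.count_eq_zero_of_notMem fun hm => hP (irreducible_monic_of_mem hm)]

theorem HasDivisorFamily.unique {g : GL (Fin n) K} {F F' : ℕ → K[X]} (h : HasDivisorFamily g F)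
    (h' : HasDivisorFamily g F') : F = F' := by
  classical
  funext i
  exact eq_of_count_normalizedFactors_eq (h.monic i) (h'.monic i) fun P hP hm =>
    h.count_eq_of_rank_eq h' hP hm hP hm rfl (fun _ => rfl) i

theorem aeval_inv_mul_pow (g : GL (Fin n) K) (P : K[X]) :
    aeval ((g⁻¹ : GL (Fin n) K) : Matrix (Fin n) (Fin n) K) P *
      (g ^ P.natDegree : GL (Fin n) K) = aeval (g : Matrix (Fin n) (Fin n) K) P.reverse := by
  rw [aeval_eq_sum_range, aeval_eq_sum_range' (Nat.lt_succ_of_le P.reverse_natDegree_le),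
    Finset.sum_mul, ← Finset.sum_range_reflect]
  refine Finset.sum_congr rfl fun i hi => ?_
  have hi' : i ≤ P.natDegree := Nat.lt_succ_iff.1 (Finset.mem_range.1 hi)
  rw [coeff_reverse, revAt_le (by omega), smul_mul_assoc,
    show P.natDegree + 1 - 1 - i = P.natDegree - i by omega]
  congr 1
  rw [← Units.val_pow_eq_pow_val, ← Units.val_pow_eq_pow_val, ← Units.val_mul]
  congr 1
  obtain ⟨m, hm⟩ := Nat.exists_eq_add_of_le hi'
  rw [hm, Nat.add_sub_cancel_left, inv_pow, add_comm, pow_add, inv_mul_cancel_left]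

theorem rank_aeval_inv (g : GL (Fin n) K) {P : K[X]} (hP : P.coeff 0 ≠ 0) (k : ℕ) :
    (aeval ((g⁻¹ : GL (Fin n) K) : Matrix (Fin n) (Fin n) K) (P ^ k)).rank =
      (aeval (g : Matrix (Fin n) (Fin n) K) (starPoly P ^ k)).rank := by
  have hPk : (P ^ k).coeff 0 ≠ 0 := by
    rw [coeff_zero_eq_eval_zero, eval_pow, ← coeff_zero_eq_eval_zero]
    exact pow_ne_zero _ hP
  have h1 : starPoly P ^ k = starPoly (P ^ k) :=
    (map_pow (⟨⟨starPoly, starPoly_one⟩, starPoly_mul⟩ : K[X] →* K[X]) P k).symm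
  have h2 : IsUnit (algebraMap K (Matrix (Fin n) (Fin n) K) ((P ^ k).coeff 0)⁻¹).det :=
    (Matrix.isUnit_iff_isUnit_det _).1 ((isUnit_iff_ne_zero.2 (inv_ne_zero hPk)).map _)
  rw [h1, starPoly_eq hPk, map_mul, aeval_C, ← aeval_inv_mul_pow,
    Matrix.rank_mul_eq_right_of_isUnit_det _ _ h2,
    Matrix.rank_mul_eq_left_of_isUnit_det _ _ (Matrix.isUnits_det_units _)]

/-- P(g⁻¹) times a power of `g` is the reversed polynomial at `g`, so the ranks for `P` at g⁻¹ are
those for `starPoly P` at `g`. -/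
theorem HasDivisorFamily.inv {g : GL (Fin n) K} {F F' : ℕ → K[X]} (h : HasDivisorFamily g F)
    (h' : HasDivisorFamily g⁻¹ F') (i : ℕ) : F' i = starPoly (F i) := by
  classical
  refine eq_of_count_normalizedFactors_eq (h'.monic i) (starPoly_monic (h.monic i).ne_zero)
    fun P hP hm => ?_
  -- If P(0) = 0 then X divides `P`, and `P` divides neither family member, as their constant terms
  -- are nonzero.
  by_cases h0 : P.coeff 0 = 0
  · have hnot : ∀ f : K[X], f.coeff 0 ≠ 0 → (normalizedFactors f).count P = 0 := fun f hf => by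
      refine Multiset.count_eq_zero_of_notMem fun hmem => hf ?_
      exact X_dvd_iff.1 ((X_dvd_iff.2 h0).trans (dvd_of_mem_normalizedFactors hmem))
    rw [hnot _ (h'.coeff_zero_ne_zero i), hnot]
    rw [starPoly_eq (h.coeff_zero_ne_zero i), coeff_C_mul, coeff_zero_reverse, (h.monic i), mul_one]
    exact inv_ne_zero (h.coeff_zero_ne_zero i)
  · rw [count_normalizedFactors_starPoly (h.monic i) hm]
    exact h'.count_eq_of_rank_eq h hP hm (starPoly_irreducible hP) (starPoly_monic hP.ne_zero)
      (natDegree_starPoly P).symm (rank_aeval_inv g h0) i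

end Classification

/-! ### Conjugacy classes of GL_n and divisor families. -/

section Conjugacy

open Module Polynomial UniqueFactorizationMonoid

variable {K : Type*} [Field K] {n : ℕ}

theorem nonempty_aeval_equiv_iff {g g' : GL (Fin n) K} :
    Nonempty (AEval' (Matrix.toLin' (g : Matrix (Fin n) (Fin n) K)) ≃ₗ[K[X]]
      AEval' (Matrix.toLin' (g' : Matrix (Fin n) (Fin n) K))) ↔ IsConj g g' := by
  set φ := Matrix.toLin' (g : Matrix (Fin n) (Fin n) K) with hφ
  set φ' := Matrix.toLin' (g' : Matrix (Fin n) (Fin n) K) with hφ'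
  rw [isConj_iff]
  constructor
  · rintro ⟨e⟩
    let c : (Fin n → K) ≃ₗ[K] (Fin n → K) :=
      (AEval'.of φ).trans ((e.restrictScalars K).trans (AEval'.of φ').symm)
    have hc : c.toLinearMap ∘ₗ φ = φ' ∘ₗ c.toLinearMap := by
      refine LinearMap.ext fun y => ?_
      have : e (AEval'.of φ (φ y)) = (X : K[X]) • e (AEval'.of φ y) := by
        rw [← map_smul]
        congr 1
        exact (AEval.X_smul_of φ y).symm
      change (AEval'.of φ').symm (e (AEval'.of φ (φ y))) =
        φ' ((AEval'.of φ').symm (e (AEval'.of φ y)))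
      rw [this]
      exact AEval.of_symm_X_smul φ' _
    refine ⟨Matrix.GeneralLinearGroup.mkOfDetNeZero (LinearMap.toMatrix' c.toLinearMap) (by
      rw [LinearMap.det_toMatrix']; exact c.isUnit_det'.ne_zero), ?_⟩
    rw [mul_inv_eq_iff_eq_mul]
    ext1
    have := congrArg LinearMap.toMatrix' hc
    rw [LinearMap.toMatrix'_comp, LinearMap.toMatrix'_comp, hφ, hφ', LinearMap.toMatrix'_toLin',
      LinearMap.toMatrix'_toLin'] at this
    simpa [Matrix.GeneralLinearGroup.mkOfDetNeZero] using this
  · rintro ⟨y, hy⟩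
    have hy' : (y : Matrix (Fin n) (Fin n) K) * g = g' * y :=
      congrArg Units.val (mul_inv_eq_iff_eq_mul.1 hy)
    let c : (Fin n → K) ≃ₗ[K] (Fin n → K) := Matrix.toLin'OfInv
      (M' := (y : Matrix (Fin n) (Fin n) K)) (M := (y⁻¹ : GL (Fin n) K))
      (by rw [← Units.val_mul, inv_mul_cancel, Units.val_one])
      (by rw [← Units.val_mul, mul_inv_cancel, Units.val_one])
    refine ⟨LinearEquiv.ofAEval φ (c.trans (AEval'.of φ')) fun m => ?_⟩
    have h1 : c (φ m) = φ' (c m) := by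
      change Matrix.toLin' (y : Matrix (Fin n) (Fin n) K) (φ m) =
        φ' (Matrix.toLin' (y : Matrix (Fin n) (Fin n) K) m)
      rw [hφ, hφ', ← Matrix.toLin'_mul_apply, ← Matrix.toLin'_mul_apply, hy']
    change AEval'.of φ' (c (φ m)) = X • AEval'.of φ' (c m)
    rw [h1]
    exact (AEval.X_smul_of φ' _).symm

theorem HasDivisorFamily.of_isConj {g g' : GL (Fin n) K} {F : ℕ → K[X]} (h : HasDivisorFamily g F)
    (hg : IsConj g g') : HasDivisorFamily g' F := by
  obtain ⟨r, p, a, h, hF⟩ := h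
  obtain ⟨e⟩ := nonempty_aeval_equiv_iff.2 hg
  exact ⟨r, p, a, ⟨h.1, h.2.1, h.2.2.map fun e' => e.symm.trans e'⟩, hF⟩

theorem exists_equiv_of_card_fiber_eq {ι ι' α : Type*} [Fintype ι] [Fintype ι'] [DecidableEq α]
    {f : ι → α} {f' : ι' → α}
    (h : ∀ x, (Finset.univ.filter fun j => f j = x).card =
      (Finset.univ.filter fun j => f' j = x).card) : ∃ σ : ι ≃ ι', ∀ j, f' (σ j) = f j := by
  let e : ∀ x, {j // f j = x} ≃ {j // f' j = x} := fun x =>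
    Fintype.equivOfCardEq (by rw [Fintype.card_subtype, Fintype.card_subtype, h])
  refine ⟨(Equiv.sigmaFiberEquiv f).symm.trans
    ((Equiv.sigmaCongrRight e).trans (Equiv.sigmaFiberEquiv f')), fun j => ?_⟩
  exact (e (f j) ⟨j, rfl⟩).2

theorem HasDivisorFamily.isConj {g g' : GL (Fin n) K} {F : ℕ → K[X]} (h : HasDivisorFamily g F)
    (h' : HasDivisorFamily g' F) : IsConj g g' := by
  classical
  obtain ⟨r, p, a, h, hF⟩ := h
  obtain ⟨r', p', a', h', hF'⟩ := h'
  -- The multiplicities of `P` in F_i count the j with (a_j, p_j) = (i, P), so the two lists of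
  -- elementary divisors agree up to a permutation.
  obtain ⟨σ, hσ⟩ := exists_equiv_of_card_fiber_eq (f := fun j => (a j, p j))
    (f' := fun j => (a' j, p' j)) (by
      rintro ⟨i, P⟩
      simp only [Prod.mk.injEq]
      rw [← h.count_eq, ← h'.count_eq, ← hF, ← hF'])
  obtain rfl : a = fun j => a' (σ j) := funext fun j => (congrArg Prod.fst (hσ j)).symm
  obtain rfl : p = fun j => p' (σ j) := funext fun j => (congrArg Prod.snd (hσ j)).symm
  obtain ⟨e⟩ := h.nonempty_pi
  obtain ⟨e'⟩ := h'.nonempty_pi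
  exact nonempty_aeval_equiv_iff.1 ⟨(e.trans (LinearEquiv.piCongrLeft K[X]
    (fun j => K[X] ⧸ Ideal.span {p' j ^ a' j}) σ)).trans e'.symm⟩

theorem HasDivisorFamily.of_equiv {g : GL (Fin n) K} {ι : Type*} [Fintype ι] (p : ι → K[X])
    (a : ι → ℕ) (hp : ∀ j, (p j).Monic ∧ Irreducible (p j)) (ha : ∀ j, 0 < a j)
    (e : AEval' (Matrix.toLin' (g : Matrix (Fin n) (Fin n) K)) ≃ₗ[K[X]]
      ∀ j, K[X] ⧸ Ideal.span {p j ^ a j}) :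
    HasDivisorFamily g fun i => ∏ j with a j = i, p j := by
  let σ := Fintype.equivFin ι
  refine ⟨Fintype.card ι, fun j => p (σ.symm j), fun j => a (σ.symm j),
    ⟨fun j => hp _, fun j => ha _, ⟨(e.trans (LinearEquiv.piCongrLeft K[X]
      (fun j => K[X] ⧸ Ideal.span {p j ^ a j}) σ.symm).symm).trans
        (DirectSum.linearEquivFunOnFintype K[X] _ _).symm⟩⟩, fun i => ?_⟩
  change ∏ j with a j = i, p j = ∏ j with a (σ.symm j) = i, p (σ.symm j)
  rw [Finset.prod_filter, Finset.prod_filter]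
  exact (Equiv.prod_comp σ.symm fun j => if a j = i then p j else 1).symm

theorem exists_hasDivisorFamily (g : GL (Fin n) K) : ∃ F, HasDivisorFamily g F := by
  classical
  set φ := Matrix.toLin' (g : Matrix (Fin n) (Fin n) K) with hφ
  obtain ⟨ι, _, p, hp, a, ⟨e⟩⟩ := Module.equiv_directSum_of_isTorsion (R := K[X]) (M := AEval' φ)
    (AEval.isTorsion_of_finiteDimensional K (Fin n → K) φ)
  have hspan : ∀ j, Ideal.span {normalize (p j) ^ a j} = K[X] ∙ p j ^ a j := fun j =>
    Ideal.span_singleton_eq_span_singleton.2 ((normalize_associated _).pow_pow)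
  let e₁ := (e.trans (DirectSum.linearEquivFunOnFintype K[X] ι _)).trans
    (LinearEquiv.piCongrRight fun j => Submodule.quotEquivOfEq _ _ (hspan j).symm)
  -- The structure theorem allows exponent 0; `ρ` discards those trivial summands.
  let ρ : (∀ j, K[X] ⧸ Ideal.span {normalize (p j) ^ a j}) →ₗ[K[X]]
      ∀ j : {j // 0 < a j}, K[X] ⧸ Ideal.span {normalize (p j) ^ a j} :=
    LinearMap.pi fun j => LinearMap.proj j.1
  have hρ : Function.Bijective ρ := by
    constructor
    · intro x y hxy
      funext j
      by_cases hj : 0 < a j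
      · exact congrFun hxy ⟨j, hj⟩
      · have : Subsingleton (K[X] ⧸ Ideal.span {normalize (p j) ^ a j}) :=
          Ideal.Quotient.subsingleton_iff.2 (by
            rw [Nat.eq_zero_of_not_pos hj, pow_zero, Ideal.span_singleton_one])
        exact Subsingleton.elim _ _
    · intro y
      refine ⟨fun j => if hj : 0 < a j then y ⟨j, hj⟩ else 0, funext fun j => ?_⟩
      exact dif_pos j.2
  exact ⟨_, HasDivisorFamily.of_equiv (fun j : {j // 0 < a j} => normalize (p j)) (fun j => a j)
    (fun j => ⟨monic_normalize (hp j).ne_zero, (normalize_associated _).symm.irreducible (hp j)⟩)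
    (fun j => j.2) (e₁.trans (LinearEquiv.ofBijective ρ hρ))⟩

/-- Multiplication by X on the direct sum of cyclic modules, transported to K^n by equality of
dimensions; it is invertible because F_i(0) ≠ 0. -/
theorem exists_hasDivisorFamily_eq {F : ℕ → K[X]} (hm : ∀ i, (F i).Monic)
    (h0 : ∀ i, (F i).coeff 0 ≠ 0) (hF0 : F 0 = 1) (hF : ∀ i, n < i → F i = 1)
    (hsum : ∑ i ∈ Finset.range (n + 1), (F i).natDegree * i = n) :
    ∃ g : GL (Fin n) K, HasDivisorFamily g F := by
  classical
  let l : ℕ → List K[X] := fun i => (normalizedFactors (F i)).toList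
  let ι := Σ i : Fin (n + 1), Fin (l i).length
  let p : ι → K[X] := fun x => (l x.1).get x.2
  let a : ι → ℕ := fun x => x.1
  have hmem : ∀ x, p x ∈ normalizedFactors (F (a x)) := fun x =>
    Multiset.mem_toList.1 (List.get_mem _ _)
  have hp : ∀ x, (p x).Monic ∧ Irreducible (p x) := fun x =>
    (irreducible_monic_of_mem (hmem x)).symm
  have ha : ∀ x, 0 < a x := fun x => by
    rw [Nat.pos_iff_ne_zero]
    intro hx
    have := hmem x
    rw [hx, hF0, normalizedFactors_one] at this
    simp at this
  have hl : ∀ i, ∏ k : Fin (l i).length, (l i).get k = F i := fun i => by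
    rw [← prod_normalizedFactors_of_monic (hm i), ← Multiset.prod_toList]
    exact Fin.prod_univ_getElem _
  have hprod : (fun i => ∏ x with a x = i, p x) = F := by
    funext i
    rw [Finset.prod_filter, Fintype.prod_sigma]
    have : ∀ i' : Fin (n + 1), (∏ k : Fin (l i').length, if a ⟨i', k⟩ = i then p ⟨i', k⟩ else 1) =
        if (i' : ℕ) = i then F i else 1 := fun i' => by
      by_cases hi : (i' : ℕ) = i
      · rw [if_pos hi, ← hi, ← hl]
        exact Finset.prod_congr rfl fun k _ => if_pos rfl
      · rw [if_neg hi]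
        exact Finset.prod_eq_one fun k _ => if_neg hi
    rw [Fintype.prod_congr _ _ this, Fin.prod_univ_eq_prod_range (fun i' => if i' = i then F i else 1),
      Finset.prod_ite_eq']
    split_ifs with hi
    · rfl
    · rw [hF i (by simpa using hi)]
  let W := ∀ x, K[X] ⧸ Ideal.span {p x ^ a x}
  have hfd : ∀ x, FiniteDimensional K (K[X] ⧸ Ideal.span {p x ^ a x}) := fun x =>
    finiteDimensional_quotient_span (pow_ne_zero _ (hp x).2.ne_zero)
  have hW : finrank K W = finrank K (Fin n → K) := by
    rw [Module.finrank_pi_fintype, finrank_fin_fun]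
    conv_rhs => rw [← hsum]
    simp only [finrank_quotient_span_eq_natDegree]
    rw [Fintype.sum_sigma, Fin.sum_univ_eq_sum_range
      (fun i => ∑ k : Fin (l i).length, ((l i).get k ^ i).natDegree)]
    refine Finset.sum_congr rfl fun i _ => ?_
    rw [← hl, natDegree_prod_of_monic _ _ fun k _ =>
      (irreducible_monic_of_mem (Multiset.mem_toList.1 (List.get_mem _ _))).2, Finset.sum_mul]
    exact Finset.sum_congr rfl fun k _ => by rw [natDegree_pow, mul_comm]
  let e : W ≃ₗ[K] (Fin n → K) := LinearEquiv.ofFinrankEq _ _ hW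
  let φ : (Fin n → K) →ₗ[K] (Fin n → K) := e.toLinearMap ∘ₗ polySmul W X ∘ₗ e.symm.toLinearMap
  have hdet : (LinearMap.toMatrix' φ).det ≠ 0 := by
    rw [LinearMap.det_toMatrix', LinearMap.det_conj,
      det_polySmul_pi _ fun x => pow_ne_zero _ (hp x).2.ne_zero, Finset.prod_ne_zero_iff]
    intro x _
    rw [det_polySmul_pow (hp x).2.ne_zero, det_polySmul_X (hp x).1]
    refine pow_ne_zero _ (mul_ne_zero (pow_ne_zero _ (neg_ne_zero.2 one_ne_zero)) fun h => ?_)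
    exact h0 (a x) (X_dvd_iff.1 ((X_dvd_iff.2 h).trans (dvd_of_mem_normalizedFactors (hmem x))))
  refine ⟨Matrix.GeneralLinearGroup.mkOfDetNeZero _ hdet, ?_⟩
  rw [← hprod]
  refine HasDivisorFamily.of_equiv p a hp ha (LinearEquiv.ofAEval _ e.symm fun m => ?_)
  change e.symm (Matrix.toLin' (LinearMap.toMatrix' φ) m) = _
  rw [Matrix.toLin'_toMatrix']
  change e.symm (e (polySmul W X (e.symm m))) = _
  rw [e.symm_apply_apply]
  rfl

theorem HasDivisorFamily.isRealElement_iff {g : GL (Fin n) K} {F : ℕ → K[X]}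
    (h : HasDivisorFamily g F) : IsRealElement g ↔ ∀ i, IsSelfReciprocal (F i) := by
  have h1 : IsRealElement g ↔ IsConj g g⁻¹ := isConj_iff.symm
  rw [h1]
  obtain ⟨F', h'⟩ := exists_hasDivisorFamily g⁻¹
  constructor
  · intro hc i
    rw [isSelfReciprocal_iff (h.monic i) (h.coeff_zero_ne_zero i), ← h.inv h' i,
      (h.of_isConj hc).unique h']
  · intro hs
    have : F' = F := funext fun i => by
      rw [h.inv h' i, (isSelfReciprocal_iff (h.monic i) (h.coeff_zero_ne_zero i)).1 (hs i)]
    exact h.isConj (this ▸ h')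

end Conjugacy

/-! ### Splitting of a GL_n class into SL_n classes. -/

section ClassSplitting

open Module Polynomial

variable {K : Type*} [Field K] {n : ℕ}

/-- If t in SL_n conjugates `s` to `s'`, then y⁻¹t⁻¹y' centralizes `G` and has determinant det(y)⁻¹
det(y'). Conversely, a centralizing c of that determinant gives t = y'c⁻¹y⁻¹. So the SL_n classes
inside a GL_n class are the cosets of `detCentralizer G`. -/
theorem isConj_iff_inv_mul_mem_detCentralizer {G y y' : GL (Fin n) K} {s s' : SL(n, K)}
    (hs : Matrix.SpecialLinearGroup.toGL s = y * G * y⁻¹)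
    (hs' : Matrix.SpecialLinearGroup.toGL s' = y' * G * y'⁻¹) :
    IsConj s s' ↔ (Matrix.GeneralLinearGroup.det y)⁻¹ * Matrix.GeneralLinearGroup.det y' ∈
      detCentralizer G := by
  rw [isConj_iff, mem_detCentralizer]
  constructor
  · rintro ⟨t, ht⟩
    have h1 : Matrix.SpecialLinearGroup.toGL t * (y * G * y⁻¹) *
        (Matrix.SpecialLinearGroup.toGL t)⁻¹ = y' * G * y'⁻¹ := by
      rw [← hs, ← hs', ← ht, map_mul, map_mul, map_inv]
    refine ⟨y⁻¹ * (Matrix.SpecialLinearGroup.toGL t)⁻¹ * y', ?_, ?_⟩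
    · have h2 : y' * G = Matrix.SpecialLinearGroup.toGL t * (y * G * y⁻¹) *
        (Matrix.SpecialLinearGroup.toGL t)⁻¹ * y' := by
        rw [h1, inv_mul_cancel_right]
      rw [mul_assoc, h2]
      group
    · have h3 : Matrix.GeneralLinearGroup.det (Matrix.SpecialLinearGroup.toGL t) = 1 :=
        Units.ext t.2
      rw [map_mul, map_mul, map_inv, map_inv, h3, inv_one, mul_one]
  · rintro ⟨c, hc, hdet⟩
    obtain ⟨t, ht⟩ := exists_toGL_eq (y := y' * c⁻¹ * y⁻¹) (by
      rw [map_mul, map_mul, map_inv, map_inv, hdet, mul_inv, inv_inv,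
        mul_comm (Matrix.GeneralLinearGroup.det y), mul_inv_cancel_left, mul_inv_cancel])
    refine ⟨t, Matrix.SpecialLinearGroup.toGL_injective ?_⟩
    have h7 : c⁻¹ * G * c = G := by rw [mul_assoc, ← hc, inv_mul_cancel_left]
    rw [map_mul, map_mul, map_inv, hs, hs', ht]
    calc y' * c⁻¹ * y⁻¹ * (y * G * y⁻¹) * (y' * c⁻¹ * y⁻¹)⁻¹ = y' * (c⁻¹ * G * c) * y'⁻¹ := by group
      _ = _ := by rw [h7]

/-- The number of classes of `SL(n, K)` in a class of `GL(n, K)`. -/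
theorem card_conjClasses_hasDivisorFamily [Finite K] (h2 : (2 : K) ≠ 0) (hn : n ≠ 0) {g : SL(n, K)}
    {F : ℕ → K[X]} (h : HasDivisorFamily (Matrix.SpecialLinearGroup.toGL g) F) {ν : n.Partition}
    (hν : ∀ i, ν.parts.count i = (F i).natDegree) :
    Nat.card {C : ConjClasses SL(n, K) // ∃ s, ConjClasses.mk s = C ∧
      HasDivisorFamily (Matrix.SpecialLinearGroup.toGL s) F} = hNu (Nat.card K) ν := by
  set G := Matrix.SpecialLinearGroup.toGL g with hG
  have hindex : Nat.card (Kˣ ⧸ detCentralizer G) = hNu (Nat.card K) ν := by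
    change (detCentralizer G).index = _
    rw [h.detCentralizer_eq h2 hn hν, IsCyclic.index_powMonoidHom_range, Nat.card_units, hNu]
  rw [← hindex]
  have : Nonempty (Fin n) := Fin.pos_iff_nonempty.1 (Nat.pos_of_ne_zero hn)
  choose y hy using Matrix.GeneralLinearGroup.det_surjective (n := Fin n) (R := K)
  have hex : ∀ z : GL (Fin n) K, ∃ s : SL(n, K),
      Matrix.SpecialLinearGroup.toGL s = z * G * z⁻¹ := fun z => exists_toGL_eq (by
    have : Matrix.GeneralLinearGroup.det G = 1 := Units.ext g.2
    rw [map_mul, map_mul, map_inv, this, mul_one, mul_inv_cancel])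
  choose s hs using hex
  symm
  refine Nat.card_eq_of_bijective (fun x : Kˣ ⧸ detCentralizer G =>
    ⟨ConjClasses.mk (s (y x.out)), s (y x.out), rfl, ?_⟩) ⟨?_, ?_⟩
  · rw [hs]
    exact h.of_isConj (isConj_iff.2 ⟨_, rfl⟩)
  · intro a b hab
    have h1 := ConjClasses.mk_eq_mk_iff_isConj.1 (congrArg Subtype.val hab)
    rw [isConj_iff_inv_mul_mem_detCentralizer (hs _) (hs _), hy, hy, ← QuotientGroup.eq] at h1
    simpa using h1
  · rintro ⟨_, t, rfl, ht⟩
    obtain ⟨z, hz⟩ := isConj_iff.1 (h.isConj ht)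
    refine ⟨(Matrix.GeneralLinearGroup.det z : Kˣ), Subtype.ext ?_⟩
    refine ConjClasses.mk_eq_mk_iff_isConj.2 ?_
    rw [isConj_iff_inv_mul_mem_detCentralizer (hs _) hz.symm, hy, ← QuotientGroup.eq]
    simp

end ClassSplitting

/-! ### Counting self-reciprocal polynomials, with and without sign. -/

section Counting

open Polynomial

variable {K : Type*} [Field K]

/-- The monic polynomials of degree `d` with constant term `c` whose coefficients are symmetric up
to the factor `c`. -/
def SymmetricPoly (K : Type*) [Field K] (d : ℕ) (c : K) : Type _ :=
  {f : K[X] // f.natDegree = d ∧ f.Monic ∧ f.coeff 0 = c ∧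
    ∀ k ≤ d, f.coeff (d - k) = c * f.coeff k}

theorem natDegree_monic_of_coeff {d : ℕ} {f : K[X]} (h1 : f.coeff d = 1)
    (h2 : ∀ k, d < k → f.coeff k = 0) : f.natDegree = d ∧ f.Monic := by
  have hd : f.natDegree = d := natDegree_eq_of_le_of_coeff_ne_zero
    (natDegree_le_iff_coeff_eq_zero.2 fun k hk => h2 k hk) (by rw [h1]; exact one_ne_zero)
  exact ⟨hd, by rw [Monic, leadingCoeff, hd, h1]⟩

/-- The coefficients of X, …, X^t are free and determine the rest. For d even, the middle
coefficient is free when c = 1 but must vanish when c = -1, since 2 ≠ 0; this accounts for the two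
values of t. -/
theorem card_symmetricPoly [Finite K] (h2 : (2 : K) ≠ 0) {d t : ℕ} (hd : 0 < d) {c : K}
    (hc : c = 1 ∧ t = d / 2 ∨ c = -1 ∧ t = (d - 1) / 2) :
    Nat.card (SymmetricPoly K d c) = Nat.card K ^ t := by
  have hcc : c * c = 1 := by rcases hc with ⟨rfl, _⟩ | ⟨rfl, _⟩ <;> ring
  have htd : t < d := by omega
  have ht2 : 2 * t ≤ d := by omega
  have hcard : Nat.card (Fin t → K) = Nat.card K ^ t := by
    rw [Nat.card_fun, Nat.card_fin]
  rw [← hcard]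
  refine Nat.card_eq_of_bijective (fun f j => f.1.coeff (j + 1)) ⟨?_, ?_⟩
  · rintro ⟨f, hfd, hfm, hf0, hf⟩ ⟨f', hfd', hfm', hf0', hf'⟩ hff
    have h1 : ∀ k, 0 < k → k ≤ t → f.coeff k = f'.coeff k := fun k hk hkt => by
      have := congrFun hff ⟨k - 1, by omega⟩
      simpa [Nat.sub_add_cancel hk] using this
    refine Subtype.ext (Polynomial.ext fun k => ?_)
    change f.coeff k = f'.coeff k
    rcases Nat.lt_or_ge d k with hk | hk
    · rw [coeff_eq_zero_of_natDegree_lt (by omega), coeff_eq_zero_of_natDegree_lt (by omega)]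
    rcases Nat.eq_zero_or_pos k with rfl | hk0
    · rw [hf0, hf0']
    rcases hk.eq_or_lt with rfl | hkd
    · have h3 := hfm.coeff_natDegree
      have h4 := hfm'.coeff_natDegree
      rw [hfd] at h3
      rw [hfd'] at h4
      rw [h3, h4]
    by_cases hkt : k ≤ t
    · exact h1 k hk0 hkt
    by_cases hkt' : d - k ≤ t
    · have h3 := hf (d - k) (by omega)
      have h4 := hf' (d - k) (by omega)
      rw [Nat.sub_sub_self hk] at h3 h4
      rw [h3, h4, h1 _ (by omega) hkt']
    · rcases hc with ⟨rfl, ht⟩ | ⟨rfl, ht⟩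
      · omega
      · have hkk : d - k = k := by omega
        have h3 := hf k hk
        have h4 := hf' k hk
        rw [hkk] at h3 h4
        have h5 : 2 * f.coeff k = 0 := by linear_combination h3
        have h6 : 2 * f'.coeff k = 0 := by linear_combination h4
        rw [(mul_eq_zero.1 h5).resolve_left h2, (mul_eq_zero.1 h6).resolve_left h2]
  · intro v
    -- `w` shifts the index by one because the constant term is prescribed; the final 0 in `a` is
    -- the middle coefficient in the antisymmetric case.
    let w : ℕ → K := fun k => if h : k - 1 < t then v ⟨k - 1, h⟩ else 0
    let a : ℕ → K := fun k => if k = 0 then c else if k = d then 1 else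
      if k ≤ t then w k else if d - k ≤ t then c * w (d - k) else 0
    let f : K[X] := ∑ k ∈ Finset.range (d + 1), monomial k (a k)
    have hf : ∀ k, f.coeff k = if k ≤ d then a k else 0 := fun k => by
      simp only [f, finsetSum_coeff, coeff_monomial, Finset.sum_ite_eq', Finset.mem_range,
        Nat.lt_succ_iff]
    obtain ⟨hfd, hfm⟩ := natDegree_monic_of_coeff (d := d) (f := f)
      (by rw [hf, if_pos le_rfl]; simp [a, hd.ne'])
      (fun k hk => by rw [hf, if_neg (by omega)])
    refine ⟨⟨f, hfd, hfm, by rw [hf, if_pos (Nat.zero_le _)]; simp [a], fun k hk => ?_⟩, ?_⟩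
    · rw [hf, hf, if_pos (Nat.sub_le _ _), if_pos hk]
      rcases Nat.eq_zero_or_pos k with rfl | hk0
      · simp [a, hd.ne', hcc]
      rcases hk.eq_or_lt with rfl | hkd
      · simp [a, hd.ne']
      simp only [a]
      rw [if_neg (show d - k ≠ 0 by omega), if_neg (show d - k ≠ d by omega), if_neg hk0.ne',
        if_neg hkd.ne, Nat.sub_sub_self hk]
      by_cases hkt : k ≤ t
      · by_cases hkt' : d - k ≤ t
        · rcases hc with ⟨rfl, ht⟩ | ⟨rfl, ht⟩
          · rw [if_pos hkt', if_pos hkt, show d - k = k by omega, one_mul]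
          · omega
        · rw [if_neg hkt', if_pos hkt, if_pos hkt]
      · by_cases hkt' : d - k ≤ t
        · rw [if_pos hkt', if_neg hkt, if_pos hkt', ← mul_assoc, hcc, one_mul]
        · rw [if_neg hkt', if_neg hkt, if_neg hkt, if_neg hkt', mul_zero]
    · funext j
      have hj := j.2
      change f.coeff (j + 1) = v j
      rw [hf, if_pos (by omega)]
      simp only [a, w]
      rw [if_neg (by omega), if_neg (by omega), if_pos (by omega), dif_pos (by omega)]
      rfl

/-- The monic self-reciprocal polynomials of degree `d` with nonzero constant term. -/
def MonicSelfReciprocal (K : Type*) [Field K] (d : ℕ) : Type _ :=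
  {f : K[X] // f.Monic ∧ f.natDegree = d ∧ f.coeff 0 ≠ 0 ∧ IsSelfReciprocal f}

theorem isSelfReciprocal_iff_coeff {f : K[X]} (hf : f.Monic) (h0 : f.coeff 0 ≠ 0) :
    IsSelfReciprocal f ↔ (f.coeff 0 = 1 ∨ f.coeff 0 = -1) ∧
      ∀ k ≤ f.natDegree, f.coeff (f.natDegree - k) = f.coeff 0 * f.coeff k := by
  rw [isSelfReciprocal_iff hf h0, starPoly_eq h0]
  have h1 : C (f.coeff 0)⁻¹ * f.reverse = f ↔ f.reverse = C (f.coeff 0) * f := by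
    constructor
    · intro h
      refine Eq.trans ?_ (congrArg (C (f.coeff 0) * ·) h)
      rw [← mul_assoc, ← C_mul, mul_inv_cancel₀ h0, C_1, one_mul]
    · intro h
      rw [h, ← mul_assoc, ← C_mul, inv_mul_cancel₀ h0, C_1, one_mul]
  rw [h1]
  constructor
  · intro h
    have hk : ∀ k ≤ f.natDegree, f.coeff (f.natDegree - k) = f.coeff 0 * f.coeff k := fun k hk => by
      have := congrArg (fun p => coeff p k) h
      simpa only [coeff_reverse, revAt_le hk, coeff_C_mul] using this
    refine ⟨mul_self_eq_one_iff.1 ?_, hk⟩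
    rw [← hk 0 (Nat.zero_le _), Nat.sub_zero, hf.coeff_natDegree]
  · rintro ⟨-, h⟩
    ext k
    rw [coeff_C_mul, coeff_reverse]
    rcases Nat.lt_or_ge f.natDegree k with hk | hk
    · rw [revAt_eq_self_of_lt hk, coeff_eq_zero_of_natDegree_lt hk, mul_zero]
    · rw [revAt_le hk, h k hk]

/-- The sign of the determinant of an element with characteristic polynomial `f`. -/
noncomputable def detSign (f : K[X]) : ℤ :=
  open Classical in (-1) ^ f.natDegree * if f.coeff 0 = 1 then 1 else -1

theorem MonicSelfReciprocal.cast_detSign {d : ℕ} (f : MonicSelfReciprocal K d) :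
    ((detSign f.1 : ℤ) : K) = (-1) ^ f.1.natDegree * f.1.coeff 0 := by
  have := ((isSelfReciprocal_iff_coeff f.2.1 f.2.2.2.1).1 f.2.2.2.2).1
  rw [detSign]
  split_ifs with h
  · rw [h]; push_cast; rfl
  · rw [this.resolve_left h]; push_cast; rfl

theorem detSign_eq_or (f : K[X]) : detSign f = 1 ∨ detSign f = -1 := by
  rw [detSign]
  rcases neg_one_pow_eq_or ℤ f.natDegree with h | h <;> rw [h] <;> split_ifs <;> simp

/-- Self-reciprocal polynomials are symmetric or antisymmetric. -/
noncomputable def monicSelfReciprocalEquiv (h2 : (2 : K) ≠ 0) (d : ℕ) :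
    MonicSelfReciprocal K d ≃ SymmetricPoly K d 1 ⊕ SymmetricPoly K d (-1) := by
  classical
  have hne : (-1 : K) ≠ 1 := fun h => h2 (by linear_combination -h)
  refine
  { toFun := fun f =>
      if h : f.1.coeff 0 = 1 then Sum.inl ⟨f.1, ?_⟩ else Sum.inr ⟨f.1, ?_⟩
    invFun := Sum.elim (fun f => ⟨f.1, ?_⟩) (fun f => ⟨f.1, ?_⟩)
    left_inv := fun f => ?_
    right_inv := fun f => ?_ }
  · obtain ⟨h1, h3⟩ := (isSelfReciprocal_iff_coeff f.2.1 f.2.2.2.1).1 f.2.2.2.2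
    rw [f.2.2.1, h] at h3
    exact ⟨f.2.2.1, f.2.1, h, h3⟩
  · obtain ⟨h1, h3⟩ := (isSelfReciprocal_iff_coeff f.2.1 f.2.2.2.1).1 f.2.2.2.2
    rw [f.2.2.1, h1.resolve_left h] at h3
    exact ⟨f.2.2.1, f.2.1, h1.resolve_left h, h3⟩
  · have h0 : f.1.coeff 0 ≠ 0 := by rw [f.2.2.2.1]; exact one_ne_zero
    refine ⟨f.2.2.1, f.2.1, h0, (isSelfReciprocal_iff_coeff f.2.2.1 h0).2 ⟨Or.inl f.2.2.2.1, ?_⟩⟩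
    rw [f.2.1, f.2.2.2.1]
    exact f.2.2.2.2
  · have h0 : f.1.coeff 0 ≠ 0 := by rw [f.2.2.2.1]; exact neg_ne_zero.2 one_ne_zero
    refine ⟨f.2.2.1, f.2.1, h0, (isSelfReciprocal_iff_coeff f.2.2.1 h0).2 ⟨Or.inr f.2.2.2.1, ?_⟩⟩
    rw [f.2.1, f.2.2.2.1]
    exact f.2.2.2.2
  · by_cases h : f.1.coeff 0 = 1 <;> simp [h] <;> rfl
  · rcases f with f | f
    · have : f.1.coeff 0 = 1 := f.2.2.2.1
      exact dif_pos this
    · have : f.1.coeff 0 ≠ 1 := by rw [f.2.2.2.1]; exact hne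
      exact dif_neg this

theorem finite_of_natDegree_eq [Finite K] {d : ℕ} {P : K[X] → Prop} (hP : ∀ f, P f → f.natDegree = d) :
    Finite {f // P f} := by
  refine Finite.of_injective (β := Fin (d + 1) → K) (fun f k => f.1.coeff k) fun f g hfg => ?_
  refine Subtype.ext (Polynomial.ext fun k => ?_)
  rcases Nat.lt_or_ge d k with hk | hk
  · rw [coeff_eq_zero_of_natDegree_lt (by rw [hP _ f.2]; exact hk),
      coeff_eq_zero_of_natDegree_lt (by rw [hP _ g.2]; exact hk)]
  · exact congrFun hfg ⟨k, Nat.lt_succ_of_le hk⟩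

instance [Finite K] (d : ℕ) (c : K) : Finite (SymmetricPoly K d c) :=
  finite_of_natDegree_eq fun _ h => h.1

instance [Finite K] (d : ℕ) : Finite (MonicSelfReciprocal K d) :=
  finite_of_natDegree_eq fun _ h => h.2.1

theorem card_monicSelfReciprocal [Finite K] (h2 : (2 : K) ≠ 0) {d : ℕ} (hd : 0 < d) :
    Nat.card (MonicSelfReciprocal K d) = Nat.card K ^ (d / 2) + Nat.card K ^ ((d - 1) / 2) := by
  rw [Nat.card_congr (monicSelfReciprocalEquiv h2 d), Nat.card_sum,
    card_symmetricPoly h2 hd (Or.inl ⟨rfl, rfl⟩), card_symmetricPoly h2 hd (Or.inr ⟨rfl, rfl⟩)]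

/-- Up to (-1)^d, the sum is the number of symmetric minus the number of antisymmetric polynomials.
The two counts are equal for odd d. -/
theorem sum_detSign [Finite K] [∀ d, Fintype (MonicSelfReciprocal K d)] (h2 : (2 : K) ≠ 0) {d : ℕ}
    (hd : 0 < d) : ∑ f : MonicSelfReciprocal K d, detSign f.1 =
      (-1) ^ d * ((Nat.card K : ℤ) ^ (d / 2) - (Nat.card K : ℤ) ^ ((d - 1) / 2)) := by
  have := Fintype.ofFinite (SymmetricPoly K d 1)
  have := Fintype.ofFinite (SymmetricPoly K d (-1))
  have hne : (-1 : K) ≠ 1 := fun h => h2 (by linear_combination -h)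
  rw [← Equiv.sum_comp (monicSelfReciprocalEquiv h2 d).symm, Fintype.sum_sum_type]
  have h1 : ∀ f : SymmetricPoly K d 1,
      detSign ((monicSelfReciprocalEquiv h2 d).symm (Sum.inl f)).1 = (-1) ^ d := fun f => by
    change detSign f.1 = _
    rw [detSign, if_pos f.2.2.2.1, f.2.1, mul_one]
  have h3 : ∀ f : SymmetricPoly K d (-1),
      detSign ((monicSelfReciprocalEquiv h2 d).symm (Sum.inr f)).1 = -(-1) ^ d := fun f => by
    change detSign f.1 = _
    rw [detSign, if_neg (by rw [f.2.2.2.1]; exact hne), f.2.1]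
    ring
  simp only [h1, h3, Finset.sum_const, Finset.card_univ, ← Nat.card_eq_fintype_card]
  rw [card_symmetricPoly h2 hd (Or.inl ⟨rfl, rfl⟩), card_symmetricPoly h2 hd (Or.inr ⟨rfl, rfl⟩)]
  simp only [nsmul_eq_mul]
  push_cast
  ring

theorem isSelfReciprocal_C_mul {c : K} (hc : c ≠ 0) (f : K[X]) :
    IsSelfReciprocal (C c * f) ↔ IsSelfReciprocal f := by
  rw [IsSelfReciprocal, IsSelfReciprocal, aroots_C_mul _ hc]

/-- Rescaling exchanges the normalizations f(0) = 1 and f monic without moving roots. -/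
theorem numSelfReciprocal_eq (K : Type*) [Field K] (d : ℕ) :
    numSelfReciprocal K d = Nat.card (MonicSelfReciprocal K d) := by
  refine Nat.card_congr
    { toFun := fun f => ⟨C f.1.leadingCoeff⁻¹ * f.1, ?_⟩
      invFun := fun f => ⟨C (f.1.coeff 0)⁻¹ * f.1, ?_⟩
      left_inv := fun f => Subtype.ext ?_
      right_inv := fun f => Subtype.ext ?_ }
  · have hl : f.1.leadingCoeff ≠ 0 := leadingCoeff_ne_zero.2 fun h => by
      have := f.2.2.1
      rw [h, coeff_zero] at this
      exact zero_ne_one this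
    refine ⟨?_, ?_, ?_, ?_⟩
    · rw [Monic, leadingCoeff_mul, leadingCoeff_C, inv_mul_cancel₀ hl]
    · rw [natDegree_C_mul (inv_ne_zero hl), f.2.1]
    · rw [coeff_C_mul, f.2.2.1, mul_one]
      exact inv_ne_zero hl
    · exact (isSelfReciprocal_C_mul (inv_ne_zero hl) _).2 f.2.2.2
  · have h0 := f.2.2.2.1
    refine ⟨?_, ?_, ?_⟩
    · rw [natDegree_C_mul (inv_ne_zero h0), f.2.2.1]
    · rw [coeff_C_mul, inv_mul_cancel₀ h0]
    · exact (isSelfReciprocal_C_mul (inv_ne_zero h0) _).2 f.2.2.2.2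
  · have hl : f.1.leadingCoeff ≠ 0 := leadingCoeff_ne_zero.2 fun h => by
      have := f.2.2.1
      rw [h, coeff_zero] at this
      exact zero_ne_one this
    simp only [coeff_C_mul, f.2.2.1, mul_one, inv_inv]
    rw [← mul_assoc, ← C_mul, mul_inv_cancel₀ hl, C_1, one_mul]
  · have h0 := f.2.2.2.1
    simp only [leadingCoeff_mul, leadingCoeff_C, f.2.1.leadingCoeff, mul_one, inv_inv]
    rw [← mul_assoc, ← C_mul, mul_inv_cancel₀ h0, C_1, one_mul]

end Counting

/-! ### Self-reciprocal families of determinant 1. -/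

section DivisorFamilies

open Polynomial

/-- The indicator of total sign 1 is (1 + ∏ e)/2, and the sum over all families of ∏ e factors over
the index set. -/
theorem card_prod_sign_eq_one {ι : Type*} [Fintype ι] [DecidableEq ι] {X : ι → Type*}
    [∀ i, Fintype (X i)] (e : ∀ i, X i → ℤ) (he : ∀ i x, e i x = 1 ∨ e i x = -1) :
    (Nat.card {F : ∀ i, X i // ∏ i, e i (F i) = 1} : ℚ) =
      (∏ i, (Nat.card (X i) : ℚ) + ∏ i, ((∑ x, e i x : ℤ) : ℚ)) / 2 := by
  have h1 : ∀ F : ∀ i, X i, ((if ∏ i, e i (F i) = 1 then 1 else 0 : ℕ) : ℚ) =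
      (1 + ∏ i, (e i (F i) : ℚ)) / 2 := fun F => by
    have : ∏ i, e i (F i) = 1 ∨ ∏ i, e i (F i) = -1 :=
      Finset.prod_induction _ (fun z : ℤ => z = 1 ∨ z = -1)
        (by rintro a b (rfl | rfl) (rfl | rfl) <;> simp) (Or.inl rfl) fun i _ => he i _
    rw [← Int.cast_prod]
    rcases this with h | h <;> rw [h] <;> norm_num
  rw [Nat.card_eq_fintype_card, Fintype.card_subtype, Finset.card_filter, Nat.cast_sum]
  simp only [h1]
  rw [← Finset.sum_div, Finset.sum_add_distrib]
  congr 2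
  · rw [Finset.sum_const, Finset.card_univ, Fintype.card_pi, nsmul_one, Nat.cast_prod]
    simp only [Nat.card_eq_fintype_card]
  · push_cast
    rw [Finset.prod_univ_sum, Fintype.piFinset_univ]

variable {K : Type*} [Field K] {n : ℕ}

/-- The families of self-reciprocal polynomials that classify the real elements of `GL(n, K)` of
type `ν` and determinant `1`. -/
def RealFamily (K : Type*) [Field K] {n : ℕ} (ν : n.Partition) : Type _ :=
  {F : ∀ i : ν.parts.toFinset, MonicSelfReciprocal K (ν.parts.count i.1) //
    ∏ i, detSign (F i).1 ^ i.1 = 1}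

instance [Finite K] (ν : n.Partition) : Finite (RealFamily K ν) := Subtype.finite

theorem card_realFamily [Finite K] [∀ d, Fintype (MonicSelfReciprocal K d)] (ν : n.Partition) :
    (Nat.card (RealFamily K ν) : ℚ) =
      (∏ i ∈ ν.parts.toFinset, (numSelfReciprocal K (ν.parts.count i) : ℚ) +
        ∏ i ∈ ν.parts.toFinset,
          ((∑ f : MonicSelfReciprocal K (ν.parts.count i), detSign f.1 ^ i : ℤ) : ℚ)) / 2 := by
  rw [← Finset.prod_coe_sort, ← Finset.prod_coe_sort ν.parts.toFinset fun i =>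
    ((∑ f : MonicSelfReciprocal K (ν.parts.count i), detSign f.1 ^ i : ℤ) : ℚ)]
  simp only [numSelfReciprocal_eq]
  refine card_prod_sign_eq_one
    (e := fun (i : ν.parts.toFinset) (f : MonicSelfReciprocal K (ν.parts.count i.1)) =>
      detSign f.1 ^ i.1) fun i f => ?_
  rcases detSign_eq_or f.1 with h | h
  · rw [h, one_pow]; exact Or.inl rfl
  · rw [h]; exact neg_one_pow_eq_or ℤ _

/-- For even i the sign is raised to an even power, so the signed sum is the plain count. For odd i
it is 0 if n_i is odd, and (q - 1)q^(n_i/2 - 1) if n_i is even, where the plain count is (q +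
1)q^(n_i/2 - 1). -/
theorem slNu_eq_card_realFamily [Finite K] (h2 : (2 : K) ≠ 0) (hq : Odd (Nat.card K))
    {ν : n.Partition} (hν : ∃ i, Odd i ∧ 0 < ν.parts.count i) :
    slNu K ν = Nat.card (RealFamily K ν) := by
  have := fun d => Fintype.ofFinite (MonicSelfReciprocal K d)
  have hpos : ∀ i ∈ ν.parts.toFinset, 0 < ν.parts.count i := fun i hi =>
    Multiset.count_pos.2 (Multiset.mem_toFinset.1 hi)
  have hcond : ¬ (Even (Nat.card K) ∨ ∀ i, Odd i → ν.parts.count i = 0) := by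
    obtain ⟨i, hi, hi0⟩ := hν
    rintro (h | h)
    · exact (Nat.not_even_iff_odd.2 hq) h
    · exact hi0.ne' (h i hi)
  have hsum : ∀ i, Odd i → 0 < ν.parts.count i →
      ∑ f : MonicSelfReciprocal K (ν.parts.count i), detSign f.1 ^ i =
      (-1) ^ ν.parts.count i * ((Nat.card K : ℤ) ^ (ν.parts.count i / 2) -
        (Nat.card K : ℤ) ^ ((ν.parts.count i - 1) / 2)) := fun i hi hi0 => by
    rw [← sum_detSign h2 hi0]
    refine Finset.sum_congr rfl fun f _ => ?_
    rcases detSign_eq_or f.1 with h | h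
    · rw [h, one_pow]
    · rw [h, hi.neg_one_pow]
  rw [card_realFamily, slNu, if_neg hcond]
  split_ifs with hodd
  · obtain ⟨i, hi⟩ := hodd
    obtain ⟨hi, hc⟩ := Nat.odd_mul.1 hi
    have hi0 : 0 < ν.parts.count i := hc.pos
    rw [Finset.prod_eq_zero (i := i) (f := fun i =>
      ((∑ f : MonicSelfReciprocal K (ν.parts.count i), detSign f.1 ^ i : ℤ) : ℚ))
      (Multiset.mem_toFinset.2 (Multiset.count_pos.1 hi0))]
    · ring
    · rw [hsum i hi hi0]
      obtain ⟨m, hm⟩ := hc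
      rw [show ν.parts.count i / 2 = (ν.parts.count i - 1) / 2 by omega, sub_self, mul_zero,
        Int.cast_zero]
  · push Not at hodd
    have heven : ∀ i, Odd i → Even (ν.parts.count i) := fun i hi =>
      Nat.not_odd_iff_even.1 fun h => hodd i (hi.mul h)
    have hsplit : ∀ f : ℕ → ℚ, ∏ i ∈ ν.parts.toFinset, f i =
        (∏ i ∈ ν.parts.toFinset.filter Odd, f i) * ∏ i ∈ ν.parts.toFinset.filter Even, f i :=
      fun f => by
        rw [← Finset.prod_filter_mul_prod_filter_not _ Odd]
        simp only [Nat.not_odd_iff_even]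
    rw [hsplit, hsplit]
    have hA : ∀ i ∈ ν.parts.toFinset.filter Odd, (numSelfReciprocal K (ν.parts.count i) : ℚ) =
        ((Nat.card K : ℚ) + 1) * (Nat.card K : ℚ) ^ (ν.parts.count i / 2 - 1) := fun i hi => by
      obtain ⟨hi, hio⟩ := Finset.mem_filter.1 hi
      have h0 := hpos i hi
      obtain ⟨m, hm⟩ := heven i hio
      obtain ⟨k, rfl⟩ := Nat.exists_eq_succ_of_ne_zero (show m ≠ 0 by omega)
      rw [numSelfReciprocal_eq, card_monicSelfReciprocal h2 h0,
        show ν.parts.count i / 2 = k + 1 by omega,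
        show (ν.parts.count i - 1) / 2 = k by omega, Nat.add_sub_cancel]
      push_cast
      ring
    have hB : ∀ i ∈ ν.parts.toFinset.filter Odd,
        ((∑ f : MonicSelfReciprocal K (ν.parts.count i), detSign f.1 ^ i : ℤ) : ℚ) =
        ((Nat.card K : ℚ) - 1) * (Nat.card K : ℚ) ^ (ν.parts.count i / 2 - 1) := fun i hi => by
      obtain ⟨hi, hio⟩ := Finset.mem_filter.1 hi
      have h0 := hpos i hi
      have hev := heven i hio
      rw [hsum i hio h0, hev.neg_one_pow]
      obtain ⟨m, hm⟩ := hev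
      obtain ⟨k, rfl⟩ := Nat.exists_eq_succ_of_ne_zero (show m ≠ 0 by omega)
      rw [show ν.parts.count i / 2 = k + 1 by omega,
        show (ν.parts.count i - 1) / 2 = k by omega, Nat.add_sub_cancel]
      push_cast
      ring
    have hC : ∀ i ∈ ν.parts.toFinset.filter Even,
        ((∑ f : MonicSelfReciprocal K (ν.parts.count i), detSign f.1 ^ i : ℤ) : ℚ) =
        (numSelfReciprocal K (ν.parts.count i) : ℚ) := fun i hi => by
      have : ∀ f : MonicSelfReciprocal K (ν.parts.count i), detSign f.1 ^ i = 1 := fun f => by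
        rcases detSign_eq_or f.1 with h | h
        · rw [h, one_pow]
        · rw [h, (Finset.mem_filter.1 hi).2.neg_one_pow]
      rw [Finset.sum_congr rfl fun f _ => this f, numSelfReciprocal_eq, Nat.card_eq_fintype_card]
      simp
    rw [Finset.prod_congr rfl hA, Finset.prod_congr rfl hB, Finset.prod_congr rfl hC,
      Finset.prod_mul_distrib, Finset.prod_mul_distrib, Finset.prod_const, Finset.prod_const]
    ring

/-- The family of polynomials indexed by all natural numbers. -/
noncomputable def RealFamily.extend {ν : n.Partition} (F : RealFamily K ν) (i : ℕ) : K[X] :=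
  if h : i ∈ ν.parts.toFinset then (F.1 ⟨i, h⟩).1 else 1

theorem RealFamily.extend_of_mem {ν : n.Partition} (F : RealFamily K ν) {i : ℕ}
    (h : i ∈ ν.parts.toFinset) : F.extend i = (F.1 ⟨i, h⟩).1 := dif_pos h

theorem RealFamily.extend_of_notMem {ν : n.Partition} (F : RealFamily K ν) {i : ℕ}
    (h : i ∉ ν.parts.toFinset) : F.extend i = 1 := dif_neg h

theorem RealFamily.natDegree_extend {ν : n.Partition} (F : RealFamily K ν) (i : ℕ) :
    ν.parts.count i = (F.extend i).natDegree := by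
  by_cases h : i ∈ ν.parts.toFinset
  · rw [F.extend_of_mem h, (F.1 ⟨i, h⟩).2.2.1]
  · rw [F.extend_of_notMem h, natDegree_one,
      Multiset.count_eq_zero_of_notMem fun h' => h (Multiset.mem_toFinset.2 h')]

theorem RealFamily.isSelfReciprocal_extend {ν : n.Partition} (F : RealFamily K ν) (i : ℕ) :
    IsSelfReciprocal (F.extend i) := by
  by_cases h : i ∈ ν.parts.toFinset
  · rw [F.extend_of_mem h]
    exact (F.1 ⟨i, h⟩).2.2.2.2
  · rw [F.extend_of_notMem h, IsSelfReciprocal, aroots_one]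
    rfl

theorem Nat.Partition.toFinset_subset_range (ν : n.Partition) :
    ν.parts.toFinset ⊆ Finset.range (n + 1) := fun i hi => by
  rw [Finset.mem_range, Nat.lt_succ_iff]
  exact ν.le_of_mem_parts (Multiset.mem_toFinset.1 hi)

theorem prod_range_eq_cast_prod_detSign {ν : n.Partition}
    (F : ∀ i : ν.parts.toFinset, MonicSelfReciprocal K (ν.parts.count i.1)) {F' : ℕ → K[X]}
    (hmem : ∀ i : ν.parts.toFinset, F' i.1 = (F i).1)
    (hnot : ∀ i, i ∉ ν.parts.toFinset → F' i = 1) :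
    ∏ i ∈ Finset.range (n + 1), ((-1) ^ (F' i).natDegree * (F' i).coeff 0) ^ i =
      ((∏ i, detSign (F i).1 ^ i.1 : ℤ) : K) := by
  rw [← Finset.prod_subset ν.toFinset_subset_range, ← Finset.prod_coe_sort]
  · push_cast
    refine Finset.prod_congr rfl fun i _ => ?_
    rw [MonicSelfReciprocal.cast_detSign, hmem]
  · intro i _ hi
    rw [hnot i hi]
    simp

theorem RealFamily.exists_hasDivisorFamily {ν : n.Partition} (F : RealFamily K ν) :
    ∃ s : SL(n, K), HasDivisorFamily (Matrix.SpecialLinearGroup.toGL s) F.extend := by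
  obtain ⟨g, hg⟩ := exists_hasDivisorFamily_eq (n := n) (F := F.extend) (fun i => by
      by_cases h : i ∈ ν.parts.toFinset
      · rw [F.extend_of_mem h]
        exact (F.1 ⟨i, h⟩).2.1
      · rw [F.extend_of_notMem h]
        exact monic_one) (fun i => by
      by_cases h : i ∈ ν.parts.toFinset
      · rw [F.extend_of_mem h]
        exact (F.1 ⟨i, h⟩).2.2.2.1
      · rw [F.extend_of_notMem h, coeff_one_zero]
        exact one_ne_zero)
    (F.extend_of_notMem fun h => (ν.parts_pos (Multiset.mem_toFinset.1 h)).ne' rfl)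
    (fun i hi => F.extend_of_notMem fun h => by
      have := Finset.mem_range.1 (ν.toFinset_subset_range h)
      omega) (by
      conv_rhs => rw [← ν.parts_sum, Finset.sum_multiset_count]
      rw [← Finset.sum_subset ν.toFinset_subset_range]
      · exact Finset.sum_congr rfl fun i _ => by rw [← F.natDegree_extend, smul_eq_mul]
      · intro i _ hi
        rw [F.extend_of_notMem hi, natDegree_one, zero_mul])
  obtain ⟨s, rfl⟩ := exists_toGL_eq (y := g) (Units.ext (by
    refine hg.det_eq.trans ?_
    rw [prod_range_eq_cast_prod_detSign F.1 (fun i => F.extend_of_mem i.2)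
      fun i hi => F.extend_of_notMem hi, F.2]
    simp))
  exact ⟨s, hg⟩

theorem exists_realFamily (h2 : (2 : K) ≠ 0) {s : SL(n, K)} {F' : ℕ → K[X]}
    (h : HasDivisorFamily (Matrix.SpecialLinearGroup.toGL s) F') {ν : n.Partition}
    (hν : ∀ i, ν.parts.count i = (F' i).natDegree)
    (hs : IsRealElement (Matrix.SpecialLinearGroup.toGL s)) :
    ∃ F : RealFamily K ν, F.extend = F' := by
  let F : ∀ i : ν.parts.toFinset, MonicSelfReciprocal K (ν.parts.count i.1) := fun i =>
    ⟨F' i.1, h.monic _, (hν _).symm, h.coeff_zero_ne_zero _, h.isRealElement_iff.1 hs _⟩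
  have hnot : ∀ i, i ∉ ν.parts.toFinset → F' i = 1 := fun i hi =>
    (h.monic i).natDegree_eq_zero.1 (by
      rw [← hν]
      exact Multiset.count_eq_zero_of_notMem fun h' => hi (Multiset.mem_toFinset.2 h'))
  have hdet : ((∏ i, detSign (F i).1 ^ i.1 : ℤ) : K) = 1 := by
    rw [← prod_range_eq_cast_prod_detSign F (F' := F') (fun _ => rfl) hnot, ← h.det_eq]
    exact s.2
  have hprod : ∏ i, detSign (F i).1 ^ i.1 = 1 := by
    have : ∏ i, detSign (F i).1 ^ i.1 = 1 ∨ ∏ i, detSign (F i).1 ^ i.1 = -1 :=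
      Finset.prod_induction _ (fun z : ℤ => z = 1 ∨ z = -1)
        (by rintro a b (rfl | rfl) (rfl | rfl) <;> simp) (Or.inl rfl) fun i _ => by
          rcases detSign_eq_or (F i).1 with h | h
          · rw [h, one_pow]; exact Or.inl rfl
          · rw [h]; exact neg_one_pow_eq_or ℤ _
    -- The integer sign can be read off in `K`, where 1 ≠ -1.
    refine this.resolve_right fun hneg => h2 ?_
    rw [hneg] at hdet
    push_cast at hdet
    linear_combination -hdet
  refine ⟨⟨F, hprod⟩, funext fun i => ?_⟩
  by_cases hi : i ∈ ν.parts.toFinset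
  · exact RealFamily.extend_of_mem _ hi
  · exact (RealFamily.extend_of_notMem _ hi).trans (hnot i hi).symm

theorem RealFamily.extend_injective {ν : n.Partition} :
    Function.Injective (RealFamily.extend : RealFamily K ν → ℕ → K[X]) := fun F F' h =>
  Subtype.ext (funext fun i => Subtype.ext (by
    rw [← F.extend_of_mem i.2, ← F'.extend_of_mem i.2, h]))

end DivisorFamilies

/-! ### Real classes of SL_n sorted by type. -/

section RealClasses

open Polynomial

variable {K : Type*} [Field K] {n : ℕ}

theorem exists_hasPartitionType (g : GL (Fin n) K) : ∃ ν : n.Partition, HasPartitionType g ν := by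
  obtain ⟨F, h⟩ := exists_hasDivisorFamily g
  let s : Multiset ℕ := ∑ i ∈ Finset.range (n + 1), Multiset.replicate (F i).natDegree i
  have hcount : ∀ i, s.count i = (F i).natDegree := fun i => by
    rw [Multiset.count_sum']
    simp only [Multiset.count_replicate]
    rw [Finset.sum_ite_eq']
    split_ifs with hi
    · rfl
    · rw [h.eq_one_of_lt (by simpa using hi), natDegree_one]
  refine ⟨⟨s, fun {i} hi => ?_, ?_⟩, hasPartitionType_iff.2 ⟨F, h, hcount⟩⟩
  · rw [Nat.pos_iff_ne_zero]
    rintro rfl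
    rw [← Multiset.count_ne_zero, hcount, h.zero, natDegree_one] at hi
    exact hi rfl
  · rw [Multiset.sum_sum]
    simp only [Multiset.sum_replicate, smul_eq_mul]
    exact h.sum_mul_natDegree

theorem HasPartitionType.unique {g g' : GL (Fin n) K} {ν ν' : n.Partition}
    (h : HasPartitionType g ν) (h' : HasPartitionType g' ν') (hg : IsConj g g') : ν = ν' := by
  obtain ⟨F, hF, hν⟩ := hasPartitionType_iff.1 h
  obtain ⟨F', hF', hν'⟩ := hasPartitionType_iff.1 h'
  refine Nat.Partition.ext (Multiset.ext.2 fun i => ?_)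
  rw [hν, hν', (hF.of_isConj hg).unique hF']

theorem isConj_toGL {s s' : SL(n, K)} (h : IsConj s s') :
    IsConj (Matrix.SpecialLinearGroup.toGL s) (Matrix.SpecialLinearGroup.toGL s') :=
  (Matrix.SpecialLinearGroup.toGL : SL(n, K) →* GL (Fin n) K).map_isConj h

theorem IsRealElement.toGL {s : SL(n, K)} (h : IsRealElement s) :
    IsRealElement (Matrix.SpecialLinearGroup.toGL s) := by
  obtain ⟨t, ht⟩ := h
  exact ⟨Matrix.SpecialLinearGroup.toGL t, by rw [← map_mul, ← map_inv, ← map_mul, ht, map_inv]⟩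

/-- The real conjugacy classes of `SL(n, K)` of type `ν`. -/
def RealClassesOfType (K : Type*) [Field K] {n : ℕ} (ν : n.Partition) : Type _ :=
  {C : ConjClasses SL(n, K) // ∃ s, ConjClasses.mk s = C ∧ IsRealElement s ∧
    HasPartitionType (Matrix.SpecialLinearGroup.toGL s) ν}

instance [Finite K] (ν : n.Partition) : Finite (RealClassesOfType K ν) := Subtype.finite

theorem numRealClasses_eq_sum [Finite K] :
    numRealClasses SL(n, K) = ∑ ν : n.Partition, Nat.card (RealClassesOfType K ν) := by
  rw [← Nat.card_sigma, numRealClasses]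
  symm
  refine Nat.card_eq_of_bijective (fun x => ⟨x.2.1, ?_⟩) ⟨?_, ?_⟩
  · obtain ⟨s, hs, hr, -⟩ := x.2.2
    exact ⟨s, hs, hr⟩
  · rintro ⟨ν, C, s, rfl, hr, hν⟩ ⟨ν', C', s', hs', hr', hν'⟩ h
    have hC : ConjClasses.mk s = C' := congrArg Subtype.val h
    subst hC
    obtain rfl := hν'.unique hν (isConj_toGL (ConjClasses.mk_eq_mk_iff_isConj.1 hs'))
    rfl
  · rintro ⟨C, s, hs, hr⟩
    obtain ⟨ν, hν⟩ := exists_hasPartitionType (Matrix.SpecialLinearGroup.toGL s)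
    exact ⟨⟨ν, C, s, hs, hr, hν⟩, rfl⟩

theorem card_realClassesOfType_of_even [Finite K] (hn : n ≡ 2 [MOD 4]) (hq : Nat.card K ≡ 3 [MOD 4])
    {ν : n.Partition} (hν : ∀ i ∈ ν.parts, Even i) : Nat.card (RealClassesOfType K ν) = 0 := by
  have : IsEmpty (RealClassesOfType K ν) := ⟨by
    rintro ⟨C, s, -, hr, ht⟩
    obtain ⟨F, hF, hc⟩ := hasPartitionType_iff.1 ht
    obtain ⟨i, hi, hi0⟩ := (isRealElement_iff_exists_odd hn hq hF hc hr.toGL).1 hr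
    exact Nat.not_even_iff_odd.2 hi (hν i (Multiset.count_pos.1 hi0))⟩
  exact Nat.card_of_isEmpty

/-- A real class of this type determines its family, and each family carries h_ν classes. All of
these are real: self-reciprocity gives reality in GL_n, and the odd part carries it over to SL_n. -/
theorem card_realClassesOfType [Finite K] (hn : n ≡ 2 [MOD 4]) (hq : Nat.card K ≡ 3 [MOD 4])
    (h2 : (2 : K) ≠ 0) {ν : n.Partition} (hν : ∃ i, Odd i ∧ 0 < ν.parts.count i) :
    Nat.card (RealClassesOfType K ν) = Nat.card (RealFamily K ν) * hNu (Nat.card K) ν := by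
  have hn0 : n ≠ 0 := by
    rintro rfl
    exact absurd hn (by decide)
  have := Fintype.ofFinite (RealFamily K ν)
  have hfib : ∀ F : RealFamily K ν, Nat.card {C : ConjClasses SL(n, K) // ∃ s,
      ConjClasses.mk s = C ∧ HasDivisorFamily (Matrix.SpecialLinearGroup.toGL s) F.extend} =
        hNu (Nat.card K) ν := fun F => by
    obtain ⟨g, hg⟩ := F.exists_hasDivisorFamily
    exact card_conjClasses_hasDivisorFamily h2 hn0 hg F.natDegree_extend
  have hsigma : Nat.card (Σ F : RealFamily K ν, {C : ConjClasses SL(n, K) // ∃ s,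
      ConjClasses.mk s = C ∧ HasDivisorFamily (Matrix.SpecialLinearGroup.toGL s) F.extend}) =
        Nat.card (RealFamily K ν) * hNu (Nat.card K) ν := by
    rw [Nat.card_sigma, Finset.sum_congr rfl fun F _ => hfib F, Finset.sum_const, Finset.card_univ,
      smul_eq_mul, Nat.card_eq_fintype_card (α := RealFamily K ν)]
  rw [← hsigma]
  symm
  refine Nat.card_eq_of_bijective (fun x => ⟨x.2.1, ?_⟩) ⟨?_, ?_⟩
  · obtain ⟨F, C, s, hs, hF⟩ := x
    exact ⟨s, hs, (isRealElement_iff_exists_odd hn hq hF F.natDegree_extend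
      (hF.isRealElement_iff.2 F.isSelfReciprocal_extend)).2 hν,
      hasPartitionType_iff.2 ⟨_, hF, F.natDegree_extend⟩⟩
  · rintro ⟨F, C, s, rfl, hF⟩ ⟨F', C', s', hs', hF'⟩ h
    have hC : ConjClasses.mk s = C' := congrArg Subtype.val h
    subst hC
    obtain rfl : F' = F := RealFamily.extend_injective
      ((hF'.of_isConj (isConj_toGL (ConjClasses.mk_eq_mk_iff_isConj.1 hs'))).unique hF)
    rfl
  · rintro ⟨C, s, hs, hr, ht⟩
    obtain ⟨F', hF', hc⟩ := hasPartitionType_iff.1 ht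
    obtain ⟨F, rfl⟩ := exists_realFamily h2 hF' hc hr.toGL
    exact ⟨⟨F, C, s, hs, hF'⟩, rfl⟩

end RealClasses

theorem theoremt (K : Type*) [Field K] [Finite K] (n : ℕ)
    (hn : n ≡ 2 [MOD 4]) (hq : Nat.card K ≡ 3 [MOD 4]) :
    (∀ (g : SL(n, K)) (ν : n.Partition),
      HasPartitionType (Matrix.SpecialLinearGroup.toGL g) ν →
      IsRealElement (Matrix.SpecialLinearGroup.toGL g) →
        (IsRealElement g ↔ ∃ i : ℕ, Odd i ∧ 0 < ν.parts.count i)) ∧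
    (numRealClasses SL(n, K) : ℚ) =
      ∑ ν : n.Partition, (hNu (Nat.card K) ν : ℚ) * slNu K ν -
      ∑ μ : n.Partition with ∀ i ∈ μ.parts, Even i, (hNu (Nat.card K) μ : ℚ) * slNu K μ := by
  constructor
  · intro g ν hν hg
    obtain ⟨F, hF, hc⟩ := hasPartitionType_iff.1 hν
    exact isRealElement_iff_exists_odd hn hq hF hc hg
  · have hodd : Odd (Nat.card K) := by
      have : Nat.card K % 4 = 3 := hq
      rw [Nat.odd_iff]
      omega
    have h2 : (2 : K) ≠ 0 := by
      have := Fintype.ofFinite K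
      rw [Nat.card_eq_fintype_card] at hq
      exact fun h0 => FiniteField.isSquare_neg_one_iff.1 ⟨1, by linear_combination -h0⟩ hq
    -- The all-even types give no real classes, and their terms cancel between the two sums; only
    -- types with an odd part remain to be compared.
    rw [numRealClasses_eq_sum, eq_sub_iff_add_eq, Nat.cast_sum,
      ← Finset.sum_filter_add_sum_filter_not Finset.univ
        (fun ν : n.Partition => ∀ i ∈ ν.parts, Even i),
      ← Finset.sum_filter_add_sum_filter_not Finset.univ
        (fun ν : n.Partition => ∀ i ∈ ν.parts, Even i) (fun ν =>
          (hNu (Nat.card K) ν : ℚ) * slNu K ν),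
      Finset.sum_eq_zero fun ν hν => by
        rw [card_realClassesOfType_of_even hn hq (Finset.mem_filter.1 hν).2, Nat.cast_zero],
      zero_add, add_comm]
    congr 1
    refine Finset.sum_congr rfl fun ν hν => ?_
    have hν' : ∃ i, Odd i ∧ 0 < ν.parts.count i := by
      have := (Finset.mem_filter.1 hν).2
      push Not at this
      obtain ⟨i, hi, hi'⟩ := this
      exact ⟨i, Nat.not_even_iff_odd.1 hi', Multiset.count_pos.2 hi⟩
    rw [card_realClassesOfType hn hq h2 hν', slNu_eq_card_realFamily h2 hodd hν', Nat.cast_mul,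
      mul_comm]
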